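/- Let $\mathbb{K}$ be a field, $m\ge 1$, and $0\le k\le n$ with $k\equiv n \pmod 2$. For crossingless matchings without internal components (closed circles) $a$ from $q$ to $r$ points and $b$ from $p$ to $q$ points, let $ab$ be the matching obtained by stacking $a$ on top of $b$ and deleting the circles that arise, and let $\Phi(a,b)$ be the number of these circles; let $a^*$ be the reflection of $a$ in a horizontal line. The Kauffman monoid $\mathcal{K}_n$ is the set of pairs $(a,i)$ of a crossingless matching $a$ from $n$ to $n$ points without circles and an integer $i\ge 0$, with product $(a,i)(b,j)=(ab,\,i+j+\Phi(a,b))$; the $m$-cyclic Temperley–Lieb monoid $m\mathcal{TL}_n$ is defined in the same way with $i\in\mathbb{Z}/m$. For $\delta\in\mathbb{K}$, the Temperley–Lieb algebra $\mathcal{TL}_n^{lin}(\delta)$ is the quotient of $\mathbb{K}\mathcal{K}_n$ by the relation $(\mathrm{Id}_n,1)=\delta\cdot 1$. Let $B_k^n$ be the set of crossingless matchings without circles from $k$ points (bottom) to $n$ points (top) in which no strand has both ends at the bottom, and let $\mathcal{J}_k\subseteq m\mathcal{TL}_n$ be the set of diagrams with exactly $k$ through strands. Let $W(k)$ be the $\mathcal{TL}_n^{lin}(\delta)$-representation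 with basis $B_k^n$ on which diagrams act by concatenation, where each circle is replaced by $\delta$ and a result not in $B_k^n$ is replaced by $0$. Its bilinear form is $\langle x,y\rangle_k=\delta^{\Phi(x^*,y)}$ if $x^*y=\mathrm{Id}_k$ and $0$ otherwise; let $R(k)$ be the radical of this form and $L(k)=W(k)/R(k)$. Let $\mathcal{C}_m=\mathbb{Z}/m$, and let $\Delta(k)$ be the span of $B_k^n\times\mathcal{C}_m$, on which $m\mathcal{TL}_n$ acts by concatenation (circles are counted modulo $m$ in the second entry, and a result whose first entry is not in $B_k^n$ is replaced by $0$) and the group algebra $\mathbb{K}\mathcal{C}_m$ acts on the second entry by translation. Let $\nabla(k)$ be the same space with $m\mathcal{TL}_n$ acting from the right through $*$. Let $\phi^k:\nabla(k)\times\Delta(k)\to\mathbb{K}\mathcal{C}_m$ be the bilinear map with $\phi^k((x,i),(y,j))=i+j+\Phi(x^*,y)\in\mathcal{C}_m$ if $x^*y=\mathrm{Id}_k$ and $0$ otherwise. For a $\mathbb{K}\mathcal{C}_m$-module $K$, put $\Delta(k,K)=\Delta(k)\otimes_{\mathbb{K}\mathcal{C}_m}K$, let $R(k,K)$ be the kernel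 of the map $\Delta(k,K)\to\mathrm{Hom}_{\mathbb{K}}(\nabla(k),\mathbb{K}\mathcal{C}_m)\otimes_{\mathbb{K}\mathcal{C}_m}K$ induced by $\phi^k$, and put $L(k,K)=\Delta(k,K)/R(k,K)$. Theorem. Suppose $\mathbb{K}$ contains a primitive $m$-th root of unity. Let $\zeta_m\in\mathbb{K}$ be an $m$-th root of unity (not necessarily primitive), and let $K$ be the corresponding simple $\mathcal{C}_m$-representation, on which the generator $1\in\mathbb{Z}/m$ acts as multiplication by $\zeta_m$. Then $R(k,K)$ is the radical of $\Delta(k,K)$, so that $L(k,K)$ is the head of $\Delta(k,K)$; $L(k,K)$ is a simple $m\mathcal{TL}_n$-representation with apex $\mathcal{J}_k$ (that is, $\mathcal{J}_k$ is a two-sided cell that contains an idempotent and does not act by zero on $L(k,K)$, and it is maximal with these properties in the order on two-sided cells in which $a\le b$ if and only if $b=cad$ for some $c,d$); and, for $\delta=\zeta_m$, $L(k)$ is a simple $\mathcal{TL}_n^{lin}(\zeta_m)$-representation. Both are finite-dimensional, and \[\dim_{\mathbb{K}}L(k,K)=\dim_{\mathbb{K}}L(k).\] -/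

import Mathlib

/-- Position of a boundary point on the boundary of the strip, read along the bottom line from left
to right (`Sum.inl`) and then along the top line from right to left (`Sum.inr`). -/
def boundaryPos {l n : ℕ} : Fin l ⊕ Fin n → ℕ :=
  Sum.elim (fun i => (i : ℕ)) (fun j => l + (j.rev : ℕ))

/-- Crossingless matchings without internal components, from `l` bottom points (`Sum.inl`) to `n` top
points (`Sum.inr`), up to equivalence: each boundary point has a partner, the other end of its strand,
and no two strands interleave along the boundary of the strip. -/
@[ext]
structure TLDiagram (l n : ℕ) where
  partner : Fin l ⊕ Fin n → Fin l ⊕ Fin n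
  partner_partner : ∀ p, partner (partner p) = p
  partner_ne : ∀ p, partner p ≠ p
  noncrossing : ∀ p q, ¬ (boundaryPos p < boundaryPos q ∧
    boundaryPos q < boundaryPos (partner p) ∧
    boundaryPos (partner p) < boundaryPos (partner q))

namespace TLDiagram

theorem boundaryPos_injective {l n : ℕ} :
    Function.Injective (boundaryPos : Fin l ⊕ Fin n → ℕ) := by
  rintro (i | i) (j | j) h
  all_goals simp only [boundaryPos, Sum.elim_inl, Sum.elim_inr, Fin.val_rev] at h
  · congr 1; ext; omega
  · omega
  · omega
  · congr 1; ext; omega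

/-- The identity diagram: `n` vertical strands. -/
def idDiag (n : ℕ) : TLDiagram n n where
  partner := Sum.swap
  partner_partner := Sum.swap_swap
  partner_ne := by rintro (i | i) <;> simp
  noncrossing := by
    rintro (i | i) (j | j)
    all_goals simp only [boundaryPos, Sum.elim_inl, Sum.elim_inr, Fin.val_rev, Sum.swap_inl,
      Sum.swap_inr]
    all_goals omega

/-- Reflection of a diagram across the horizontal middle line. -/
def reflect {l n : ℕ} (a : TLDiagram l n) : TLDiagram n l where
  partner p := (a.partner p.swap).swap
  partner_partner p := by simp [a.partner_partner]
  partner_ne p h := a.partner_ne p.swap (by rw [← Sum.swap_swap (a.partner p.swap), h])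
  noncrossing := by
    have key : ∀ p : Fin n ⊕ Fin l,
        boundaryPos p + boundaryPos p.swap + 1 = l + n := by
      rintro (i | i)
      all_goals simp only [boundaryPos, Sum.elim_inl, Sum.elim_inr, Fin.val_rev, Sum.swap_inl,
        Sum.swap_inr]
      all_goals omega
    intro p q
    have h1 := key p
    have h2 := key q
    have h3 := key (a.partner p.swap).swap
    have h4 := key (a.partner q.swap).swap
    have h5 := a.noncrossing (a.partner q.swap) (a.partner p.swap)
    rw [a.partner_partner, a.partner_partner] at h5
    rw [Sum.swap_swap] at h3 h4
    omega

section Gluing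

variable {l m n : ℕ}

/-- In the picture obtained by gluing a diagram from `l` to `m` points below another one, a point is
a bottom, middle or top point. This is the partner along the lower diagram; top points stay put. -/
def lowerStep (b : TLDiagram l m) : Fin l ⊕ Fin m ⊕ Fin n → Fin l ⊕ Fin m ⊕ Fin n
  | .inl i => Sum.map id Sum.inl (b.partner (.inl i))
  | .inr (.inl j) => Sum.map id Sum.inl (b.partner (.inr j))
  | .inr (.inr k) => .inr (.inr k)

/-- The partner along the upper diagram; bottom points stay put. -/
def upperStep (a : TLDiagram m n) : Fin l ⊕ Fin m ⊕ Fin n → Fin l ⊕ Fin m ⊕ Fin n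
  | .inl i => .inl i
  | .inr p => .inr (a.partner p)

/-- Two points of the glued picture are connected if they lie on the same component. -/
def Connected (a : TLDiagram m n) (b : TLDiagram l m) : Setoid (Fin l ⊕ Fin m ⊕ Fin n) :=
  Relation.EqvGen.setoid fun u v => v = lowerStep b u ∨ v = upperStep a u

/-- Inclusion of the boundary points into the glued picture. -/
def outer : Fin l ⊕ Fin n → Fin l ⊕ Fin m ⊕ Fin n :=
  Sum.map id Sum.inr

/-- The number of internal components created by stacking `a` on top of `b`: the components of the
glued picture that do not meet the boundary. -/
noncomputable def loops (a : TLDiagram m n) (b : TLDiagram l m) : ℕ :=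
  Nat.card {c : Quotient (Connected a b) //
    ∀ p : Fin l ⊕ Fin n, (Quotient.mk (Connected a b) (outer p)) ≠ c}

theorem lowerStep_invol (b : TLDiagram l m) (u : Fin l ⊕ Fin m ⊕ Fin n) :
    lowerStep b (lowerStep b u) = u := by
  have key : ∀ p : Fin l ⊕ Fin m,
      lowerStep b (Sum.map id Sum.inl p : Fin l ⊕ Fin m ⊕ Fin n) =
        Sum.map id Sum.inl (b.partner p) := by
    rintro (i | i) <;> rfl
  rcases u with i | j | k
  · change lowerStep b (Sum.map id Sum.inl (b.partner (.inl i))) = _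
    rw [key, b.partner_partner]; rfl
  · change lowerStep b (Sum.map id Sum.inl (b.partner (.inr j))) = _
    rw [key, b.partner_partner]; rfl
  · rfl

theorem upperStep_invol (a : TLDiagram m n) (u : Fin l ⊕ Fin m ⊕ Fin n) :
    upperStep a (upperStep a u) = u := by
  rcases u with i | p
  · rfl
  · simp [upperStep, a.partner_partner]

theorem lowerStep_fixed (b : TLDiagram l m) (u : Fin l ⊕ Fin m ⊕ Fin n) :
    lowerStep b u = u ↔ ∃ k, u = .inr (.inr k) := by
  have inj : Function.Injective
      (Sum.map id Sum.inl : Fin l ⊕ Fin m → Fin l ⊕ Fin m ⊕ Fin n) :=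
    Function.injective_id.sumMap Sum.inl_injective
  rcases u with i | j | k
  · refine iff_of_false (fun h => b.partner_ne (.inl i) (inj h)) (by simp)
  · refine iff_of_false (fun h => b.partner_ne (.inr j) (inj h)) (by simp)
  · simp [lowerStep]

theorem upperStep_fixed (a : TLDiagram m n) (u : Fin l ⊕ Fin m ⊕ Fin n) :
    upperStep a u = u ↔ ∃ i, u = .inl i := by
  rcases u with i | p
  · simp [upperStep]
  · simp [upperStep, a.partner_ne]

/-- A point fixed by one of two involutions without common fixed points on a finite set is connected
to exactly one other point fixed by one of them. -/
theorem existsUnique_other_end {X : Type*} [Finite X] (f g : X → X) (hf : ∀ u, f (f u) = u)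
    (hg : ∀ u, g (g u) = u) (hfg : ∀ u, ¬ (f u = u ∧ g u = u)) (x : X) (hx : g x = x) :
    ∃! y, y ≠ x ∧ Relation.EqvGen (fun u v => v = f u ∨ v = g u) x y ∧ (f y = y ∨ g y = y) := by
  classical
  set s : X → X := fun u => g (f u) with hs
  have sinj : Function.Injective s := fun u v h => by
    have h1 : f u = f v := by rw [← hg (f u), ← hg (f v)]; exact congrArg g h
    rw [← hf u, ← hf v, h1]
  have hper : x ∈ Function.periodicPts s := sinj.mem_periodicPts x
  set t := Function.minimalPeriod s x with ht
  have htpos : 0 < t := Function.minimalPeriod_pos_of_mem_periodicPts hper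
  have hst : s^[t] x = x := Function.iterate_minimalPeriod
  -- reflections of the orbit
  have hgs : ∀ i j, s^[i + j] x = x → g (s^[i] x) = s^[j] x := by
    intro i
    induction i with
    | zero =>
      intro j h
      rw [Nat.zero_add] at h
      rw [h]; exact hx
    | succ i ih =>
      intro j h
      have h1 := ih (j + 1) (by rw [← h]; congr 1; omega)
      rw [Function.iterate_succ_apply'] at h1 ⊢
      simp only [hs] at h1 ⊢
      rw [hg]
      have h2 : s^[i] x = f (s^[j] x) := by
        have h3 := congrArg g h1
        rw [hg, hg] at h3
        exact h3
      have h4 := congrArg f h2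
      rw [hf] at h4
      exact h4
  have hmod : ∀ i, s^[i + (t - i % t)] x = x := by
    intro i
    have : i + (t - i % t) = t * (i / t + 1) := by
      have h1 := Nat.div_add_mod i t
      have h2 := Nat.mod_lt i htpos
      rw [Nat.mul_add]; omega
    rw [this]
    exact (Function.isPeriodicPt_minimalPeriod s x).mul_const _
  have hfs : ∀ i, f (s^[i] x) = g (s^[i + 1] x) := by
    intro i
    rw [Function.iterate_succ_apply']
    simp only [hs]
    rw [hg]
  have orbit : ∀ y, Relation.EqvGen (fun u v => v = f u ∨ v = g u) x y → ∃ i, y = s^[i] x := by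
    have closed : ∀ u v, (v = f u ∨ v = g u) → ((∃ i, u = s^[i] x) ↔ ∃ i, v = s^[i] x) := by
      have hf' : ∀ u, (∃ i, u = s^[i] x) → ∃ i, f u = s^[i] x := by
        rintro u ⟨i, rfl⟩
        exact ⟨_, by rw [hfs]; exact hgs _ _ (hmod (i + 1))⟩
      have hg' : ∀ u, (∃ i, u = s^[i] x) → ∃ i, g u = s^[i] x := by
        rintro u ⟨i, rfl⟩
        exact ⟨_, hgs _ _ (hmod i)⟩
      rintro u v (rfl | rfl)
      · exact ⟨hf' u, fun h => by simpa [hf] using hf' _ h⟩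
      · exact ⟨hg' u, fun h => by simpa [hg] using hg' _ h⟩
    intro y h
    have key : ∀ u v, Relation.EqvGen (fun u v => v = f u ∨ v = g u) u v →
        ((∃ i, u = s^[i] x) ↔ ∃ i, v = s^[i] x) := by
      intro u v h
      induction h with
      | rel u v h => exact closed u v h
      | refl => exact Iff.rfl
      | symm u v _ ih => exact ih.symm
      | trans u v w _ _ ih1 ih2 => exact ih1.trans ih2
    exact (key x y h).1 ⟨0, rfl⟩
  have conn : ∀ i, Relation.EqvGen (fun u v => v = f u ∨ v = g u) x (s^[i] x) := by
    intro i
    induction i with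
    | zero => exact Relation.EqvGen.refl _
    | succ i ih =>
      rw [Function.iterate_succ_apply']
      exact (ih.trans _ _ _ (Relation.EqvGen.rel _ _ (Or.inl rfl))).trans _ _ _
        (Relation.EqvGen.rel _ _ (Or.inr rfl))
  have hinj : ∀ i j, i < t → j < t → s^[i] x = s^[j] x → i = j := by
    intro i j hi hj h
    exact (Function.iterate_injOn_Iio_minimalPeriod (f := s) (x := x)) hi hj h
  have hzero : ∀ i, s^[i] x = x ↔ t ∣ i := fun i =>
    Function.isPeriodicPt_iff_minimalPeriod_dvd
  have hred : ∀ i, ∃ j, j < t ∧ s^[i] x = s^[j] x := fun i =>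
    ⟨i % t, Nat.mod_lt _ htpos, (Function.iterate_mod_minimalPeriod_eq).symm⟩
  -- fixed points along the orbit
  have gfix : ∀ i, i < t → (g (s^[i] x) = s^[i] x ↔ t ∣ 2 * i) := by
    intro i hi
    rw [← hzero, two_mul]
    constructor
    · intro h
      have h1 := hgs i (t - i) (by rw [Nat.add_sub_cancel' hi.le]; exact hst)
      rw [h] at h1
      rw [Function.iterate_add_apply, h1, ← Function.iterate_add_apply, Nat.add_sub_cancel' hi.le,
        hst]
    · exact hgs i i
  have ffix : ∀ i, i < t → (f (s^[i] x) = s^[i] x ↔ t ∣ 2 * i + 1) := by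
    intro i hi
    rw [← hzero, hfs]
    constructor
    · intro h
      have h1 := hgs (i + 1) (t - (i + 1)) (by rw [Nat.add_sub_cancel' hi]; exact hst)
      rw [h] at h1
      rw [show 2 * i + 1 = i + 1 + i by ring, Function.iterate_add_apply, h1,
        ← Function.iterate_add_apply, Nat.add_sub_cancel' hi, hst]
    · intro h
      exact hgs (i + 1) i (by rw [← h]; congr 1; omega)
  have only : ∀ i, i < t → i ≠ 0 → (t ∣ 2 * i + 1 ∨ t ∣ 2 * i) → i = t / 2 := by
    rintro i hi h0 (⟨c, hc⟩ | ⟨c, hc⟩)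
    · have : c = 1 := by
        rcases c with _ | _ | c
        · omega
        · rfl
        · nlinarith
      subst this; omega
    · have : c = 1 := by
        rcases c with _ | _ | c
        · omega
        · rfl
        · nlinarith
      subst this; omega
  have ht1 : t ≠ 1 := by
    intro h
    have h1 : s x = x := by simpa [h] using hst
    refine hfg x ⟨?_, hx⟩
    have h2 := congrArg g h1
    simp only [hs] at h2
    rw [hg, hx] at h2
    exact h2
  refine ⟨s^[t / 2] x, ⟨?_, conn _, ?_⟩, ?_⟩
  · intro h
    have := hinj (t / 2) 0 (by omega) htpos h
    omega
  · rcases Nat.even_or_odd' t with ⟨c, hc | hc⟩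
    · right
      rw [gfix _ (by omega)]
      exact ⟨1, by omega⟩
    · left
      rw [ffix _ (by omega)]
      exact ⟨1, by omega⟩
  · rintro y ⟨hne, hc, hfix⟩
    obtain ⟨i, rfl⟩ := orbit y hc
    obtain ⟨j, hj, hij⟩ := hred i
    rw [hij] at hne hfix ⊢
    rw [ffix j hj, gfix j hj] at hfix
    rw [only j hj (by rintro rfl; exact hne rfl) hfix]

theorem outer_injective : Function.Injective (outer : Fin l ⊕ Fin n → Fin l ⊕ Fin m ⊕ Fin n) :=
  Function.injective_id.sumMap Sum.inr_injective

theorem existsUnique_outer (a : TLDiagram m n) (b : TLDiagram l m) (p : Fin l ⊕ Fin n) :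
    ∃! q : Fin l ⊕ Fin n, q ≠ p ∧ Connected a b (outer p) (outer q) := by
  have hno : ∀ u : Fin l ⊕ Fin m ⊕ Fin n, ¬ (lowerStep b u = u ∧ upperStep a u = u) := by
    intro u
    rw [lowerStep_fixed, upperStep_fixed]
    rintro ⟨⟨i, rfl⟩, ⟨j, h⟩⟩
    simp at h
  have hout : ∀ u : Fin l ⊕ Fin m ⊕ Fin n, (lowerStep b u = u ∨ upperStep a u = u) ↔
      ∃ q : Fin l ⊕ Fin n, u = outer q := by
    intro u
    rw [lowerStep_fixed, upperStep_fixed]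
    constructor
    · rintro (⟨k, rfl⟩ | ⟨i, rfl⟩)
      · exact ⟨.inr k, rfl⟩
      · exact ⟨.inl i, rfl⟩
    · rintro ⟨i | k, rfl⟩
      · exact Or.inr ⟨i, rfl⟩
      · exact Or.inl ⟨k, rfl⟩
  have main : ∃! y : Fin l ⊕ Fin m ⊕ Fin n, y ≠ outer p ∧ Connected a b (outer p) y ∧
      (lowerStep b y = y ∨ upperStep a y = y) := by
    rcases p with i | k
    · exact existsUnique_other_end _ _ (lowerStep_invol b) (upperStep_invol a) hno _ rfl
    · have := existsUnique_other_end (upperStep a) (lowerStep b) (upperStep_invol a)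
        (lowerStep_invol b) (fun u h => hno u h.symm) (outer (.inr k)) rfl
      have e : (fun u v : Fin l ⊕ Fin m ⊕ Fin n => v = upperStep a u ∨ v = lowerStep b u) =
          fun u v => v = lowerStep b u ∨ v = upperStep a u := by
        funext u v; exact propext or_comm
      rw [e] at this
      have e' : ∀ y : Fin l ⊕ Fin m ⊕ Fin n, (upperStep a y = y ∨ lowerStep b y = y) ↔
          (lowerStep b y = y ∨ upperStep a y = y) := fun y => or_comm
      simp only [e'] at this
      exact this
  obtain ⟨y, ⟨h1, h2, h3⟩, h4⟩ := main
  obtain ⟨q, rfl⟩ := (hout y).1 h3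
  refine ⟨q, ⟨fun h => h1 (by rw [h]), h2⟩, ?_⟩
  rintro q' ⟨h5, h6⟩
  exact outer_injective (h4 (outer q') ⟨fun h => h5 (outer_injective h), h6, (hout _).2 ⟨q', rfl⟩⟩)

/-- The indicator of `i < j`, modulo 2. -/
def ltInd (i j : ℕ) : ZMod 2 := if i < j then 1 else 0

/-- Two disjoint unions of strands interleave an even number of times. -/
theorem interleave_even (d : TLDiagram l n) (P Q : Fin l ⊕ Fin n → ZMod 2)
    (hP : ∀ x, P (d.partner x) = P x) (hQ : ∀ x, Q (d.partner x) = Q x)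
    (hPQ : ∀ x, P x = 0 ∨ Q x = 0) :
    ∑ y, Q y * ∑ x, P x * ltInd (boundaryPos x) (boundaryPos y) = 0 := by
  simp only [ltInd]
  refine Finset.sum_involution (fun y _ => d.partner y) ?_ (fun y _ _ => d.partner_ne y)
    (fun y _ => Finset.mem_univ _) (fun y _ => d.partner_partner y)
  intro y _
  rw [hQ, ← mul_add, ← Finset.sum_add_distrib]
  rcases hPQ y with hy | hy
  · have : ∑ x, (P x * (if boundaryPos x < boundaryPos y then 1 else 0) +
        P x * (if boundaryPos x < boundaryPos (d.partner y) then 1 else 0)) = 0 := by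
      refine Finset.sum_involution (fun x _ => d.partner x) ?_ (fun x _ _ => d.partner_ne x)
        (fun x _ => Finset.mem_univ _) (fun x _ => d.partner_partner x)
      intro x _
      rw [hP, ← mul_add, ← mul_add, ← mul_add]
      by_cases hx : P x = 0
      · simp [hx]
      have n1 : boundaryPos x ≠ boundaryPos y := fun h => hx (by
        rw [boundaryPos_injective h]; exact hy)
      have n2 : boundaryPos x ≠ boundaryPos (d.partner y) := fun h => hx (by
        rw [boundaryPos_injective h, hP]; exact hy)
      have n3 : boundaryPos (d.partner x) ≠ boundaryPos y := fun h => hx (by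
        rw [← hP, boundaryPos_injective h]; exact hy)
      have n4 : boundaryPos (d.partner x) ≠ boundaryPos (d.partner y) := fun h => hx (by
        rw [← hP, boundaryPos_injective h, hP]; exact hy)
      have e1 := d.noncrossing x y
      have e2 := d.noncrossing x (d.partner y)
      have e3 := d.noncrossing (d.partner x) y
      have e4 := d.noncrossing (d.partner x) (d.partner y)
      have e5 := d.noncrossing y x
      have e6 := d.noncrossing y (d.partner x)
      have e7 := d.noncrossing (d.partner y) x
      have e8 := d.noncrossing (d.partner y) (d.partner x)
      simp only [d.partner_partner] at e1 e2 e3 e4 e5 e6 e7 e8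
      have : ((if boundaryPos x < boundaryPos y then 1 else 0) +
          (if boundaryPos x < boundaryPos (d.partner y) then 1 else 0) +
          ((if boundaryPos (d.partner x) < boundaryPos y then 1 else 0) +
          (if boundaryPos (d.partner x) < boundaryPos (d.partner y) then 1 else 0)) : ZMod 2)
          = 0 := by
        split_ifs <;> first | decide | (exfalso; omega)
      rw [this, mul_zero]
    rw [this, mul_zero]
  · rw [hy, zero_mul]

theorem sum_even (d : TLDiagram l n) (P : Fin l ⊕ Fin n → ZMod 2)
    (hP : ∀ x, P (d.partner x) = P x) : ∑ x, P x = 0 := by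
  have two : ∀ z : ZMod 2, z + z = 0 := by decide
  refine Finset.sum_involution (fun y _ => d.partner y) ?_ (fun y _ _ => d.partner_ne y)
    (fun y _ => Finset.mem_univ _) (fun y _ => d.partner_partner y)
  intro y _
  rw [hP, two]

theorem connected_lower (a : TLDiagram m n) (b : TLDiagram l m) (p : Fin l ⊕ Fin m) :
    Connected a b (Sum.map id Sum.inl p) (Sum.map id Sum.inl (b.partner p)) := by
  refine Relation.EqvGen.rel _ _ (Or.inl ?_)
  rcases p with i | j <;> rfl

theorem connected_upper (a : TLDiagram m n) (b : TLDiagram l m) (p : Fin m ⊕ Fin n) :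
    Connected a b (Sum.inr p) (Sum.inr (a.partner p)) :=
  Relation.EqvGen.rel _ _ (Or.inr rfl)

/-- The composite `a ∘ b`, obtained by stacking `a` on top of `b` and forgetting the internal
components: the partner of a boundary point is the other boundary point of its component. -/
noncomputable def comp (a : TLDiagram m n) (b : TLDiagram l m) : TLDiagram l n where
  partner p := (existsUnique_outer a b p).choose
  partner_partner p := by
    have h1 := (existsUnique_outer a b p).choose_spec.1
    have h2 := (existsUnique_outer a b (existsUnique_outer a b p).choose).choose_spec.2 p
      ⟨h1.1.symm, (Connected a b).symm h1.2⟩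
    exact h2.symm
  partner_ne p := (existsUnique_outer a b p).choose_spec.1.1
  noncrossing := by
    classical
    intro p q
    have hp := (existsUnique_outer a b p).choose_spec
    have hq := (existsUnique_outer a b q).choose_spec
    generalize (existsUnique_outer a b p).choose = p' at hp ⊢
    generalize (existsUnique_outer a b q).choose = q' at hq ⊢
    obtain ⟨⟨hp1, hp2⟩, hp3⟩ := hp
    obtain ⟨⟨hq1, hq2⟩, hq3⟩ := hq
    simp only at hp3 hq3
    rintro ⟨c1, c2, c3⟩
    have npq : ¬ Connected a b (outer p) (outer q) := by
      intro h
      have hne : q ≠ p := by rintro rfl; omega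
      have := hp3 q ⟨hne, h⟩
      subst this; omega
    -- indicator functions of the two components
    set P : Fin l ⊕ Fin m ⊕ Fin n → ZMod 2 :=
      fun u => if Connected a b (outer p) u then 1 else 0 with hPdef
    set Q : Fin l ⊕ Fin m ⊕ Fin n → ZMod 2 :=
      fun u => if Connected a b (outer q) u then 1 else 0 with hQdef
    have inv : ∀ r u v : Fin l ⊕ Fin m ⊕ Fin n, Connected a b u v →
        ((if Connected a b r v then 1 else 0 : ZMod 2) = if Connected a b r u then 1 else 0) := by
      intro r u v h
      have : Connected a b r v ↔ Connected a b r u :=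
        ⟨fun h1 => (Connected a b).trans h1 ((Connected a b).symm h),
          fun h1 => (Connected a b).trans h1 h⟩
      simp only [this]
    have hPQ : ∀ u, P u = 0 ∨ Q u = 0 := by
      intro u
      by_cases h1 : Connected a b (outer p) u
      · right
        have : ¬ Connected a b (outer q) u := fun h2 =>
          npq ((Connected a b).trans h1 ((Connected a b).symm h2))
        simp [hQdef, this]
      · left; simp [hPdef, h1]
    have lowP := fun x => inv (outer p) _ _ (connected_lower a b x)
    have lowQ := fun x => inv (outer q) _ _ (connected_lower a b x)
    have upP := fun x => inv (outer p) _ _ (connected_upper a b x)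
    have upQ := fun x => inv (outer q) _ _ (connected_upper a b x)
    have L0 := interleave_even b (fun x => P (Sum.map id Sum.inl x))
      (fun x => Q (Sum.map id Sum.inl x)) lowP lowQ (fun x => hPQ _)
    have U0 := interleave_even a (fun x => P (Sum.inr x)) (fun x => Q (Sum.inr x)) upP upQ
      (fun x => hPQ _)
    have LP := sum_even b (fun x => P (Sum.map id Sum.inl x)) lowP
    have LQ := sum_even b (fun x => Q (Sum.map id Sum.inl x)) lowQ
    have UP := sum_even a (fun x => P (Sum.inr x)) upP
    have UQ := sum_even a (fun x => Q (Sum.inr x)) upQ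
    -- on the boundary the two components are `{p, p'}` and `{q, q'}`
    have bP : ∀ x : Fin l ⊕ Fin n, P (outer x) =
        (if p = x then 1 else 0) + (if p' = x then 1 else 0) := by
      intro x
      by_cases h1 : p = x
      · subst h1
        simp [hPdef, hp1]
      · by_cases h2 : p' = x
        · subst h2
          simp [hPdef, hp1.symm, hp2]
        · have : ¬ Connected a b (outer p) (outer x) := fun h =>
            h2 (hp3 x ⟨fun h => h1 h.symm, h⟩).symm
          simp [hPdef, h1, h2, this]
    have bQ : ∀ x : Fin l ⊕ Fin n, Q (outer x) =
        (if q = x then 1 else 0) + (if q' = x then 1 else 0) := by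
      intro x
      by_cases h1 : q = x
      · subst h1
        simp [hQdef, hq1]
      · by_cases h2 : q' = x
        · subst h2
          simp [hQdef, hq1.symm, hq2]
        · have : ¬ Connected a b (outer q) (outer x) := fun h =>
            h2 (hq3 x ⟨fun h => h1 h.symm, h⟩).symm
          simp [hQdef, h1, h2, this]
    have T1 : ∑ y : Fin l ⊕ Fin n, Q (outer y) * ∑ x : Fin l ⊕ Fin n, P (outer x) *
        ltInd (boundaryPos x) (boundaryPos y) = 1 := by
      simp only [bP, bQ, add_mul, Finset.sum_add_distrib, ite_mul, one_mul, zero_mul,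
        Finset.sum_ite_eq, Finset.mem_univ, if_true, ltInd]
      rw [if_pos c1, if_neg (by omega : ¬ boundaryPos p' < boundaryPos q), if_pos (by omega),
        if_pos c3]
      decide
    have T0 : ∑ y : Fin l ⊕ Fin n, Q (outer y) * ∑ x : Fin l ⊕ Fin n, P (outer x) *
        ltInd (boundaryPos x) (boundaryPos y) = 0 := by
      clear_value P Q
      have MM : (∑ y : Fin m, Q (.inr (.inl y)) * ∑ x : Fin m, P (.inr (.inl x)) *
            ltInd x.rev y.rev) +
          (∑ y : Fin m, Q (.inr (.inl y)) * ∑ x : Fin m, P (.inr (.inl x)) *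
            ltInd x y) =
          (∑ y : Fin m, Q (.inr (.inl y))) * ∑ x : Fin m, P (.inr (.inl x)) := by
        rw [← Finset.sum_add_distrib, Finset.sum_mul]
        refine Finset.sum_congr rfl fun y _ => ?_
        rw [← mul_add, ← Finset.sum_add_distrib]
        rcases hPQ (.inr (.inl y)) with h | h
        · congr 1
          refine Finset.sum_congr rfl fun x _ => ?_
          rcases lt_trichotomy (x : ℕ) (y : ℕ) with h1 | h1 | h1
          · rw [ltInd, ltInd, if_neg (by simp only [Fin.val_rev]; omega), if_pos h1]; ring
          · rw [Fin.ext h1, h]; ring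
          · rw [ltInd, ltInd, if_pos (by simp only [Fin.val_rev]; omega), if_neg (by omega)]; ring
        · rw [h]; ring
      have lm1 : ∀ (i : Fin l) (j : ℕ), ltInd i (l + j) = 1 := fun i j => if_pos (by omega)
      have lm2 : ∀ (i : Fin l) (j : ℕ), ltInd (l + j) i = 0 := fun i j => if_neg (by omega)
      have mn1 : ∀ (i : Fin m) (j : ℕ), ltInd i (m + j) = 1 := fun i j => if_pos (by omega)
      have mn2 : ∀ (i : Fin m) (j : ℕ), ltInd (m + j) i = 0 := fun i j => if_neg (by omega)
      have sh : ∀ c i j : ℕ, ltInd (c + i) (c + j) = ltInd i j := fun c i j => by simp [ltInd]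
      simp only [Fintype.sum_sum_type, boundaryPos, Sum.elim_inl, Sum.elim_inr, Sum.map_inl,
        Sum.map_inr, outer, id, lm1, lm2, mn1, mn2, sh, mul_one, mul_zero,
        Finset.sum_const_zero, add_zero] at L0 U0 LP LQ UP UQ MM ⊢
      simp only [mul_add, Finset.sum_add_distrib, ← Finset.sum_mul] at L0 U0 ⊢
      have h2 : (2 : ZMod 2) = 0 := by decide
      linear_combination L0 + U0 - MM +
        ((∑ y : Fin l, P (.inl y)) - ∑ y : Fin m, P (.inr (.inl y))) * UQ -
        (∑ y : Fin m, Q (.inr (.inl y))) * (∑ y : Fin l, P (.inl y)) * h2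
    rw [T1] at T0
    exact one_ne_zero T0

theorem connected_outer_iff (a : TLDiagram m n) (b : TLDiagram l m) (p q : Fin l ⊕ Fin n) :
    Connected a b (outer p) (outer q) ↔ q = p ∨ q = (comp a b).partner p := by
  have h := (existsUnique_outer a b p).choose_spec
  constructor
  · intro h1
    by_cases h2 : q = p
    · exact Or.inl h2
    · exact Or.inr (h.2 q ⟨h2, h1⟩)
  · rintro (rfl | rfl)
    · exact (Connected a b).refl _
    · exact h.1.2

end Gluing

/-- A two-colouring of the boundary points is compatible with a diagram if it is constant along
strands. -/
def Compatible {l n : ℕ} (a : TLDiagram l n) (s : Fin l → Bool) (t : Fin n → Bool) : Prop :=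
  ∀ p, Sum.elim s t (a.partner p) = Sum.elim s t p

open Classical in
/-- The incidence matrix of compatible colourings. It serves to prove associativity. -/
noncomputable def mat {l n : ℕ} (a : TLDiagram l n) : Matrix (Fin l → Bool) (Fin n → Bool) ℕ :=
  fun s t => if Compatible a s t then 1 else 0

theorem eq_of_compatible {l n : ℕ} (a b : TLDiagram l n)
    (h : ∀ s t, Compatible a s t → Compatible b s t) : a = b := by
  classical
  ext p
  set f : Fin l ⊕ Fin n → Bool := fun x => decide (x = p ∨ x = a.partner p) with hf
  have hs : Sum.elim (f ∘ Sum.inl) (f ∘ Sum.inr) = f := Sum.elim_comp_inl_inr f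
  have h1 := h (f ∘ Sum.inl) (f ∘ Sum.inr)
  simp only [Compatible, hs] at h1
  have h2 := h1 (by
    intro x
    simp only [hf, decide_eq_decide]
    constructor
    · rintro (h | h)
      · right; rw [← h, a.partner_partner]
      · left; rw [← a.partner_partner x, h, a.partner_partner]
    · rintro (rfl | rfl)
      · exact Or.inr rfl
      · exact Or.inl (a.partner_partner p)) p
  have h3 : b.partner p = p ∨ b.partner p = a.partner p := by
    simpa [hf] using h2
  rcases h3 with h3 | h3
  · exact absurd h3 (b.partner_ne p)
  · exact h3.symm

theorem card_middle {l m n : ℕ} (a : TLDiagram m n) (b : TLDiagram l m) (s : Fin l → Bool)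
    (u : Fin n → Bool) (h : Compatible (comp a b) s u) :
    Nat.card {t : Fin m → Bool // Compatible b s t ∧ Compatible a t u} = 2 ^ loops a b := by
  classical
  set col : (Fin m → Bool) → Fin l ⊕ Fin m ⊕ Fin n → Bool := fun t => Sum.elim s (Sum.elim t u)
    with hcol
  have colL : ∀ t p, col t (Sum.map id Sum.inl p) = Sum.elim s t p := by
    rintro t (i | i) <;> rfl
  have colU : ∀ t p, col t (Sum.inr p) = Sum.elim t u p := fun t p => rfl
  have colO : ∀ t (p : Fin l ⊕ Fin n), col t (outer p) = Sum.elim s u p := by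
    rintro t (i | i) <;> rfl
  have compat : ∀ t, (Compatible b s t ∧ Compatible a t u) ↔
      ∀ x y, Connected a b x y → col t x = col t y := by
    intro t
    constructor
    · rintro ⟨hb, ha⟩ x y hxy
      induction hxy with
      | rel x y hxy =>
        rcases hxy with rfl | rfl
        · rcases x with i | j | k
          · exact ((colL t _).trans (hb (.inl i))).symm
          · exact ((colL t _).trans (hb (.inr j))).symm
          · rfl
        · rcases x with i | p
          · rfl
          · exact (ha p).symm
      | refl => rfl
      | symm _ _ _ ih => exact ih.symm
      | trans _ _ _ _ _ ih1 ih2 => exact ih1.trans ih2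
    · intro hc
      refine ⟨fun p => ?_, fun p => ?_⟩
      · rw [← colL, ← colL]
        exact (hc _ _ (connected_lower a b p)).symm
      · exact (hc _ _ (connected_upper a b p)).symm
  have hcomp : ∀ p q : Fin l ⊕ Fin n, Connected a b (outer p) (outer q) →
      (Sum.elim s u p : Bool) = Sum.elim s u q := by
    intro p q hpq
    rcases (connected_outer_iff a b p q).1 hpq with rfl | rfl
    · rfl
    · exact (h p).symm
  let C := {c : Quotient (Connected a b) //
    ∀ p : Fin l ⊕ Fin n, (Quotient.mk (Connected a b) (outer p)) ≠ c}
  have e : {t : Fin m → Bool // Compatible b s t ∧ Compatible a t u} ≃ (C → Bool) := by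
    refine Equiv.ofBijective
      (fun t c => Quotient.lift (col t.1) ((compat t.1).1 t.2) c.1) ⟨?_, ?_⟩
    · rintro ⟨t, ht⟩ ⟨t', ht'⟩ htt
      refine Subtype.ext (funext fun j => ?_)
      by_cases hj : ∀ p : Fin l ⊕ Fin n,
          (Quotient.mk (Connected a b) (outer p)) ≠ Quotient.mk _ (.inr (.inl j))
      · exact congrFun htt ⟨_, hj⟩
      · push Not at hj
        obtain ⟨p, hp⟩ := hj
        have hp' : Connected a b (outer p) (.inr (.inl j)) := Quotient.exact hp
        have h1 := (compat t).1 ht _ _ hp'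
        have h2 := (compat t').1 ht' _ _ hp'
        rw [colO] at h1 h2
        exact h1.symm.trans h2
    · intro c
      let F : Quotient (Connected a b) → Bool := fun q =>
        if hq : ∀ p : Fin l ⊕ Fin n, (Quotient.mk (Connected a b) (outer p)) ≠ q then c ⟨q, hq⟩
        else Sum.elim s u (not_forall.1 hq).choose
      have FO : ∀ p : Fin l ⊕ Fin n, F (Quotient.mk _ (outer p)) = Sum.elim s u p := by
        intro p
        have hq : ¬ ∀ p' : Fin l ⊕ Fin n, (Quotient.mk (Connected a b) (outer p')) ≠
          Quotient.mk _ (outer p) := fun h => h p rfl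
        simp only [F, dif_neg hq]
        have := not_not.1 (not_forall.1 hq).choose_spec
        exact hcomp _ _ (Quotient.exact this)
      let t : Fin m → Bool := fun j => F (Quotient.mk _ (.inr (.inl j)))
      have hF : ∀ x, col t x = F (Quotient.mk _ x) := by
        rintro (i | j | k)
        · exact (FO (.inl i)).symm
        · rfl
        · exact (FO (.inr k)).symm
      have ht : Compatible b s t ∧ Compatible a t u := by
        rw [compat]
        intro x y hxy
        rw [hF, hF, Quotient.sound hxy]
      refine ⟨⟨t, ht⟩, funext fun c' => ?_⟩
      obtain ⟨q, hq⟩ := c'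
      induction q using Quotient.inductionOn with
      | h x =>
        change col t x = _
        rw [hF]
        simp only [F]
        rw [dif_pos hq]
  rw [Nat.card_congr e, Nat.card_fun]
  simp [loops, C]

theorem mat_mul {l m n : ℕ} (a : TLDiagram m n) (b : TLDiagram l m) :
    mat b * mat a = 2 ^ loops a b • mat (comp a b) := by
  classical
  ext s u
  have h1 : (mat b * mat a) s u =
      Nat.card {t : Fin m → Bool // Compatible b s t ∧ Compatible a t u} := by
    rw [Matrix.mul_apply, Nat.card_eq_fintype_card, Fintype.card_subtype, Finset.card_filter]
    refine Finset.sum_congr rfl fun t _ => ?_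
    simp only [mat]
    by_cases h : Compatible b s t <;> by_cases h' : Compatible a t u <;> simp [h, h']
  rw [h1, Matrix.smul_apply]
  by_cases h : Compatible (comp a b) s u
  · rw [card_middle a b s u h]
    simp [mat, h]
  · simp only [mat, h, if_false, smul_zero]
    rw [Nat.card_eq_zero]
    refine Or.inl ⟨fun ⟨t, hb, ha⟩ => h fun p => ?_⟩
    have hc : ∀ x y, Connected a b x y →
        (Sum.elim s (Sum.elim t u) x : Bool) = Sum.elim s (Sum.elim t u) y := by
      intro x y hxy
      induction hxy with
      | rel x y hxy =>
        rcases hxy with rfl | rfl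
        · rcases x with i | j | k
          · have := hb (.inl i)
            simp only [lowerStep]
            rw [Sum.elim_map]
            exact this.symm
          · have := hb (.inr j)
            simp only [lowerStep]
            rw [Sum.elim_map]
            exact this.symm
          · rfl
        · rcases x with i | p
          · rfl
          · exact (ha p).symm
      | refl => rfl
      | symm _ _ _ ih => exact ih.symm
      | trans _ _ _ _ _ ih1 ih2 => exact ih1.trans ih2
    have hO : ∀ p : Fin l ⊕ Fin n,
        (Sum.elim s (Sum.elim t u) (outer p) : Bool) = Sum.elim s u p := by
      rintro (i | i) <;> rfl
    rw [← hO, ← hO]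
    exact (hc _ _ ((connected_outer_iff a b p _).2 (Or.inr rfl))).symm

theorem mat_const {l n : ℕ} (a : TLDiagram l n) : mat a (fun _ => true) (fun _ => true) = 1 := by
  have : Compatible a (fun _ => true) (fun _ => true) := by
    intro p
    have h : ∀ q : Fin l ⊕ Fin n, (Sum.elim (fun _ => true) (fun _ => true) q : Bool) = true := by
      rintro (i | i) <;> rfl
    rw [h, h]
  simp [mat, this]

theorem eq_of_smul_mat {l n : ℕ} {i j : ℕ} {a b : TLDiagram l n}
    (h : 2 ^ i • mat a = 2 ^ j • mat b) : i = j ∧ a = b := by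
  have h1 := congrFun (congrFun h fun _ => true) fun _ => true
  rw [Matrix.smul_apply, Matrix.smul_apply, mat_const, mat_const] at h1
  have hij : i = j := Nat.pow_right_injective le_rfl (by simpa using h1)
  refine ⟨hij, eq_of_compatible a b fun s t hs => ?_⟩
  subst hij
  have h2 := congrFun (congrFun h s) t
  by_contra hb
  simp [mat, hs, hb] at h2

theorem comp_assoc_and_loops {k l m n : ℕ} (c : TLDiagram m n) (a : TLDiagram l m)
    (b : TLDiagram k l) :
    loops a b + loops c (comp a b) = loops c a + loops (comp c a) b ∧
      comp c (comp a b) = comp (comp c a) b := by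
  have h := Matrix.mul_assoc (mat b) (mat a) (mat c)
  rw [mat_mul, mat_mul, Matrix.smul_mul, Matrix.mul_smul, mat_mul, mat_mul, smul_smul, smul_smul,
    ← pow_add, ← pow_add] at h
  exact eq_of_smul_mat h

theorem comp_assoc {k l m n : ℕ} (c : TLDiagram m n) (a : TLDiagram l m) (b : TLDiagram k l) :
    comp c (comp a b) = comp (comp c a) b :=
  (comp_assoc_and_loops c a b).2

theorem loops_cocycle {k l m n : ℕ} (c : TLDiagram m n) (a : TLDiagram l m) (b : TLDiagram k l) :
    loops a b + loops c (comp a b) = loops c a + loops (comp c a) b :=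
  (comp_assoc_and_loops c a b).1

theorem mat_idDiag (n : ℕ) : mat (idDiag n) = 1 := by
  classical
  ext s t
  have : Compatible (idDiag n) s t ↔ s = t := by
    constructor
    · intro h
      funext i
      exact h (.inr i)
    · rintro rfl (i | i) <;> rfl
  simp only [mat, this, Matrix.one_apply]

theorem id_comp_and_loops {l n : ℕ} (a : TLDiagram l n) :
    loops (idDiag n) a = 0 ∧ comp (idDiag n) a = a := by
  have h := mat_mul (idDiag n) a
  rw [mat_idDiag, Matrix.mul_one] at h
  exact eq_of_smul_mat (by rw [← h, pow_zero, one_smul])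

theorem comp_id_and_loops {l n : ℕ} (a : TLDiagram l n) :
    loops a (idDiag l) = 0 ∧ comp a (idDiag l) = a := by
  have h := mat_mul a (idDiag l)
  rw [mat_idDiag, Matrix.one_mul] at h
  exact eq_of_smul_mat (by rw [← h, pow_zero, one_smul])

theorem mat_reflect {l n : ℕ} (a : TLDiagram l n) : mat (reflect a) = (mat a).transpose := by
  ext t s
  have e : ∀ p : Fin l ⊕ Fin n, (Sum.elim t s p.swap : Bool) = Sum.elim s t p := by
    rintro (i | i) <;> rfl
  have : Compatible (reflect a) t s ↔ Compatible a s t := by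
    constructor
    · intro h p
      have := h p.swap
      simp only [reflect, Sum.swap_swap] at this
      rw [e, e] at this
      exact this
    · intro h p
      have := h p.swap
      simp only [reflect]
      rw [e, this, ← e, Sum.swap_swap]
  by_cases h : Compatible a s t
  · simp [mat, Matrix.transpose_apply, this.2 h, h]
  · simp [mat, Matrix.transpose_apply, mt this.1 h, h]

theorem reflect_comp_and_loops {l m n : ℕ} (a : TLDiagram m n) (b : TLDiagram l m) :
    loops (reflect b) (reflect a) = loops a b ∧
      comp (reflect b) (reflect a) = reflect (comp a b) := by
  have h := mat_mul (reflect b) (reflect a)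
  rw [mat_reflect, mat_reflect, ← Matrix.transpose_mul, mat_mul, Matrix.transpose_smul,
    ← mat_reflect] at h
  exact eq_of_smul_mat h.symm

theorem reflect_reflect {l n : ℕ} (a : TLDiagram l n) : reflect (reflect a) = a := by
  ext p
  simp [reflect]

/-- A diagram is capless if no strand has both ends at the bottom. -/
def Capless {l n : ℕ} (a : TLDiagram l n) : Prop :=
  ∀ i j, a.partner (.inl i) ≠ .inl j

theorem Capless.of_comp {l m n : ℕ} {a : TLDiagram m n} {b : TLDiagram l m}
    (h : Capless (comp a b)) : Capless b := by
  intro i j hij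
  have h1 := connected_lower a b (.inl i)
  rw [hij] at h1
  have h2 := (connected_outer_iff a b (.inl i) (.inl j)).1 h1
  rcases h2 with h2 | h2
  · exact b.partner_ne _ (hij.trans (congrArg _ (Sum.inl.inj h2)))
  · exact h i j h2.symm

theorem capless_idDiag (n : ℕ) : Capless (idDiag n) := fun _ _ h => Sum.inr_ne_inl h

/-- The number of through strands: strands that connect the bottom with the top. -/
def throughStrands {l n : ℕ} (a : TLDiagram l n) : ℕ :=
  Fintype.card {i : Fin l // (a.partner (.inl i)).isRight}



end TLDiagram

open TLDiagram

/-- Crossingless matchings from `n` to `n` points, recorded as a matching without internal components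
together with the number of internal components, the latter counted in `Λ`. -/
@[ext]
structure CountedDiagram (Λ : Type*) (n : ℕ) where
  skeleton : TLDiagram n n
  bubbles : Λ

namespace CountedDiagram

variable {Λ : Type*} [AddCommMonoidWithOne Λ] {n : ℕ}

/-- `(a, i) (b, j) = (a b, i + j + Φ(a, b))`, where `Φ` counts the new internal components. -/
noncomputable instance : Monoid (CountedDiagram Λ n) where
  mul a b := ⟨comp a.skeleton b.skeleton, a.bubbles + b.bubbles + loops a.skeleton b.skeleton⟩
  one := ⟨idDiag n, 0⟩
  mul_assoc a b c := by
    refine CountedDiagram.ext (comp_assoc _ _ _).symm ?_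
    have h := congrArg (Nat.cast : ℕ → Λ) (loops_cocycle a.skeleton b.skeleton c.skeleton)
    push_cast at h
    change a.bubbles + b.bubbles + loops a.skeleton b.skeleton + c.bubbles +
        loops (comp a.skeleton b.skeleton) c.skeleton =
      a.bubbles + (b.bubbles + c.bubbles + loops b.skeleton c.skeleton) +
        loops a.skeleton (comp b.skeleton c.skeleton)
    calc _ = a.bubbles + b.bubbles + c.bubbles + ((loops a.skeleton b.skeleton : Λ) +
        loops (comp a.skeleton b.skeleton) c.skeleton) := by abel
      _ = _ := by rw [← h]; abel
  one_mul a := by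
    refine CountedDiagram.ext (id_comp_and_loops _).2 ?_
    change 0 + a.bubbles + loops (idDiag n) a.skeleton = a.bubbles
    rw [(id_comp_and_loops _).1]; simp
  mul_one a := by
    refine CountedDiagram.ext (comp_id_and_loops _).2 ?_
    change a.bubbles + 0 + loops a.skeleton (idDiag n) = a.bubbles
    rw [(comp_id_and_loops _).1]; simp

theorem mul_skeleton (a b : CountedDiagram Λ n) :
    (a * b).skeleton = comp a.skeleton b.skeleton := rfl

theorem mul_bubbles (a b : CountedDiagram Λ n) :
    (a * b).bubbles = a.bubbles + b.bubbles + loops a.skeleton b.skeleton := rfl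

theorem one_skeleton : (1 : CountedDiagram Λ n).skeleton = idDiag n := rfl

theorem one_bubbles : (1 : CountedDiagram Λ n).bubbles = 0 := rfl

/-- The diagrammatic anti-involution. -/
def star (a : CountedDiagram Λ n) : CountedDiagram Λ n :=
  ⟨reflect a.skeleton, a.bubbles⟩

end CountedDiagram

/-- The Kauffman monoid on `n` strands. -/
abbrev KauffmanMonoid (n : ℕ) := CountedDiagram ℕ n

/-- The `m`-cyclic Temperley–Lieb monoid on `n` strands: internal components are counted modulo
`m`. -/
abbrev CyclicTLMonoid (m n : ℕ) := CountedDiagram (ZMod m) n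

/-- The diagrams from `k` to `n` points without caps (and without internal components). -/
abbrev HalfDiagram (k n : ℕ) := {x : TLDiagram k n // Capless x}

section Cell

variable {Λ : Type*} [AddCommMonoidWithOne Λ] {A : Type*} [CommRing A]
  (τ : Multiplicative Λ →* A) (k n : ℕ)

open Classical in
/-- Concatenation of a diagram on top of a half diagram `x`; `i` internal components are replaced by
the scalar `τ i`, and the result is zero if it has a cap, i.e. fewer than `k` through strands. -/
noncomputable def cellActBasis (a : CountedDiagram Λ n) (x : HalfDiagram k n) :
    HalfDiagram k n →₀ A :=
  if h : Capless (comp a.skeleton x.1) then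
    Finsupp.single ⟨comp a.skeleton x.1, h⟩
      (τ (Multiplicative.ofAdd (a.bubbles + (loops a.skeleton x.1 : Λ))))
  else 0

/-- The action of diagrams on the free `A`-module on half diagrams by concatenation. -/
noncomputable def cellAction :
    CountedDiagram Λ n →* Module.End A (HalfDiagram k n →₀ A) where
  toFun a := Finsupp.linearCombination A (cellActBasis τ k n a)
  map_one' := by
    refine Finsupp.lhom_ext' fun x => LinearMap.ext_ring ?_
    have h1 := id_comp_and_loops x.1
    have h : Capless (comp (1 : CountedDiagram Λ n).skeleton x.1) := by
      rw [CountedDiagram.one_skeleton, h1.2]; exact x.2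
    simp only [LinearMap.coe_comp, Function.comp_apply, Finsupp.lsingle_apply,
      Finsupp.linearCombination_single, one_smul, Module.End.one_apply, cellActBasis, dif_pos h]
    congr 1
    · exact Subtype.ext h1.2
    · rw [CountedDiagram.one_skeleton, h1.1]
      simp [CountedDiagram.one_bubbles]
  map_mul' a b := by
    refine Finsupp.lhom_ext' fun x => LinearMap.ext_ring ?_
    simp only [LinearMap.coe_comp, Function.comp_apply, Finsupp.lsingle_apply,
      Finsupp.linearCombination_single, one_smul, Module.End.mul_apply]
    have hassoc := comp_assoc a.skeleton b.skeleton x.1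
    have hloops := loops_cocycle a.skeleton b.skeleton x.1
    by_cases hb : Capless (comp b.skeleton x.1)
    · have e1 : cellActBasis τ k n b x = Finsupp.single ⟨comp b.skeleton x.1, hb⟩
          (τ (Multiplicative.ofAdd (b.bubbles + (loops b.skeleton x.1 : Λ)))) := dif_pos hb
      rw [e1, Finsupp.linearCombination_single]
      by_cases ha : Capless (comp a.skeleton (comp b.skeleton x.1))
      · have ha' : Capless (comp (a * b).skeleton x.1) := by
          rw [CountedDiagram.mul_skeleton, ← hassoc]; exact ha
        rw [cellActBasis, cellActBasis, dif_pos ha', dif_pos ha, Finsupp.smul_single, smul_eq_mul,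
          ← map_mul, ← ofAdd_add]
        congr 1
        · exact Subtype.ext hassoc.symm
        · congr 2
          have h := congrArg (Nat.cast : ℕ → Λ) hloops
          push_cast at h
          rw [CountedDiagram.mul_bubbles, CountedDiagram.mul_skeleton]
          calc _ = a.bubbles + b.bubbles + ((loops a.skeleton b.skeleton : Λ) +
              loops (comp a.skeleton b.skeleton) x.1) := by abel
            _ = _ := by rw [← h]; abel
      · have ha' : ¬ Capless (comp (a * b).skeleton x.1) := by
          rw [CountedDiagram.mul_skeleton, ← hassoc]; exact ha
        rw [cellActBasis, cellActBasis, dif_neg ha', dif_neg ha, smul_zero]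
    · have hab : ¬ Capless (comp (a * b).skeleton x.1) := fun h => hb (by
        rw [CountedDiagram.mul_skeleton, ← hassoc] at h; exact h.of_comp)
      rw [cellActBasis, cellActBasis, dif_neg hab, dif_neg hb, map_zero]

open Classical in
/-- The value of the bilinear map on half diagrams `y` and `x`: stack `y*` on top of `x`. If the
result is the identity diagram on `k` strands together with `i` internal components, the value is
`τ i`; otherwise it is zero. -/
noncomputable def cellPairingBasis (y x : HalfDiagram k n) : A :=
  if comp (reflect y.1) x.1 = idDiag k then
    τ (Multiplicative.ofAdd (loops (reflect y.1) x.1 : Λ))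
  else 0

/-- The bilinear map on the free `A`-module on half diagrams. -/
noncomputable def cellPairing :
    (HalfDiagram k n →₀ A) →ₗ[A] (HalfDiagram k n →₀ A) →ₗ[A] A :=
  Finsupp.linearCombination A fun y => Finsupp.linearCombination A (cellPairingBasis τ k n y)

theorem cellPairing_single (y x : HalfDiagram k n) :
    cellPairing τ k n (Finsupp.single y 1) (Finsupp.single x 1) = cellPairingBasis τ k n y x := by
  simp [cellPairing]

theorem cellPairing_action (a : CountedDiagram Λ n) (w v : HalfDiagram k n →₀ A) :
    cellPairing τ k n w (cellAction τ k n a v) = cellPairing τ k n (cellAction τ k n a.star w) v := by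
  have key : (cellPairing τ k n).compl₂ (cellAction τ k n a) =
      (cellPairing τ k n) ∘ₗ (cellAction τ k n a.star) := by
    refine Finsupp.lhom_ext' fun y => LinearMap.ext_ring ?_
    refine Finsupp.lhom_ext' fun x => LinearMap.ext_ring ?_
    simp only [LinearMap.coe_comp, Function.comp_apply, Finsupp.lsingle_apply,
      LinearMap.compl₂_apply]
    have eL : cellAction τ k n a (Finsupp.single x 1) = cellActBasis τ k n a x := by
      simp [cellAction]
    have eR : cellAction τ k n a.star (Finsupp.single y 1) = cellActBasis τ k n a.star y := by
      simp [cellAction]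
    rw [eL, eR]
    have hassoc := comp_assoc (reflect y.1) a.skeleton x.1
    have hloops := loops_cocycle (reflect y.1) a.skeleton x.1
    have hr := reflect_comp_and_loops (reflect a.skeleton) y.1
    rw [reflect_reflect] at hr
    have lhs : cellPairing τ k n (Finsupp.single y 1) (cellActBasis τ k n a x) =
        open Classical in
        if comp (reflect y.1) (comp a.skeleton x.1) = idDiag k then
          τ (Multiplicative.ofAdd (a.bubbles + ((loops a.skeleton x.1 +
            loops (reflect y.1) (comp a.skeleton x.1) : ℕ) : Λ))) else 0 := by
      by_cases h : Capless (comp a.skeleton x.1)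
      · rw [cellActBasis, dif_pos h, ← mul_one (τ _), ← smul_eq_mul, ← Finsupp.smul_single,
          map_smul, cellPairing_single, cellPairingBasis]
        simp only
        split_ifs
        · rw [smul_eq_mul, ← map_mul, ← ofAdd_add, Nat.cast_add, add_assoc]
        · rw [smul_zero]
      · rw [cellActBasis, dif_neg h, map_zero, if_neg]
        intro h'
        refine h (Capless.of_comp (a := reflect y.1) ?_)
        rw [h']; exact capless_idDiag k
    have rhs : cellPairing τ k n (cellActBasis τ k n a.star y) (Finsupp.single x 1) =
        open Classical in
        if comp (comp (reflect y.1) a.skeleton) x.1 = idDiag k then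
          τ (Multiplicative.ofAdd (a.bubbles + ((loops (reflect y.1) a.skeleton +
            loops (comp (reflect y.1) a.skeleton) x.1 : ℕ) : Λ))) else 0 := by
      have hr2 : reflect (comp a.star.skeleton y.1) = comp (reflect y.1) a.skeleton := hr.2.symm
      by_cases h : Capless (comp a.star.skeleton y.1)
      · rw [cellActBasis, dif_pos h, ← mul_one (τ _), ← smul_eq_mul, ← Finsupp.smul_single,
          map_smul, LinearMap.smul_apply, cellPairing_single, cellPairingBasis]
        have hl : loops a.star.skeleton y.1 = loops (reflect y.1) a.skeleton := hr.1.symm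
        simp only [hl]
        rw [hr2]
        split_ifs
        · rw [smul_eq_mul, ← map_mul, ← ofAdd_add, Nat.cast_add, add_assoc]
          rfl
        · rw [smul_zero]
      · rw [cellActBasis, dif_neg h, map_zero, LinearMap.zero_apply, if_neg]
        intro h'
        refine h (Capless.of_comp (a := reflect x.1) ?_)
        have := (reflect_comp_and_loops (reflect (comp a.star.skeleton y.1)) x.1).2
        rw [reflect_reflect, hr2, h'] at this
        rw [this]
        exact capless_idDiag k
    rw [lhs, rhs, ← hassoc, hloops]
  exact LinearMap.congr_fun (LinearMap.congr_fun key w) v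

end Cell

section TLAlgebra

variable {𝕜 : Type*} [Field 𝕜] (δ : 𝕜) (k n : ℕ)

/-- The relation `o = δ · 1` on the algebra of the Kauffman monoid, where `o` is the identity diagram
with one internal component. -/
inductive TLRel : MonoidAlgebra 𝕜 (KauffmanMonoid n) → MonoidAlgebra 𝕜 (KauffmanMonoid n) → Prop
  | bubble : TLRel (MonoidAlgebra.of 𝕜 (KauffmanMonoid n) ⟨idDiag n, 1⟩)
      (algebraMap 𝕜 (MonoidAlgebra 𝕜 (KauffmanMonoid n)) δ)

/-- The Temperley–Lieb algebra with parameter `δ`. -/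
abbrev TLAlgebra := RingQuot (TLRel δ n)

/-- The underlying space of the cell representation `W(k)` of the Temperley–Lieb algebra: the span of
the half diagrams. -/
def TLCell (_δ : 𝕜) (k n : ℕ) := HalfDiagram k n →₀ 𝕜

noncomputable instance : AddCommGroup (TLCell δ k n) :=
  inferInstanceAs (AddCommGroup (HalfDiagram k n →₀ 𝕜))

noncomputable instance : Module 𝕜 (TLCell δ k n) :=
  inferInstanceAs (Module 𝕜 (HalfDiagram k n →₀ 𝕜))

/-- The action of the Temperley–Lieb algebra on `W(k)` by concatenation: internal components are
removed, each giving a factor `δ`. -/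
noncomputable def tlCellHom : TLAlgebra δ n →ₐ[𝕜] Module.End 𝕜 (HalfDiagram k n →₀ 𝕜) :=
  RingQuot.liftAlgHom 𝕜 ⟨MonoidAlgebra.lift 𝕜 (Module.End 𝕜 (HalfDiagram k n →₀ 𝕜))
    (KauffmanMonoid n) (cellAction (powersHom 𝕜 δ) k n), by
      rintro _ _ ⟨⟩
      rw [MonoidAlgebra.lift_of, AlgHom.commutes]
      refine Finsupp.lhom_ext' fun x => LinearMap.ext_ring ?_
      have h1 := id_comp_and_loops x.1
      have h : Capless (comp (idDiag n) x.1) := by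
        rw [h1.2]; exact x.2
      simp only [cellAction, MonoidHom.coe_mk, OneHom.coe_mk, LinearMap.coe_comp,
        Function.comp_apply, Finsupp.lsingle_apply, Finsupp.linearCombination_single, one_smul,
        cellActBasis, dif_pos h, h1.1]
      rw [Module.algebraMap_end_apply, Finsupp.smul_single]
      congr 1
      · exact Subtype.ext h1.2
      · simp⟩

noncomputable instance : Module (TLAlgebra δ n) (TLCell δ k n) :=
  Module.compHom (HalfDiagram k n →₀ 𝕜) (tlCellHom δ k n).toRingHom

theorem tlCell_smul_def (r : TLAlgebra δ n) (v : TLCell δ k n) : r • v = tlCellHom δ k n r v := rfl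

instance : IsScalarTower 𝕜 (TLAlgebra δ n) (TLCell δ k n) where
  smul_assoc c r v := by
    rw [tlCell_smul_def, tlCell_smul_def, map_smul]; rfl

/-- The canonical bilinear form on `W(k)`. -/
noncomputable def tlForm : TLCell δ k n →ₗ[𝕜] TLCell δ k n →ₗ[𝕜] 𝕜 :=
  cellPairing (powersHom 𝕜 δ) k n

/-- The radical `R(k)` of the canonical bilinear form, as a subrepresentation of `W(k)`. -/
noncomputable def tlRadical : Submodule (TLAlgebra δ n) (TLCell δ k n) where
  carrier := {v | ∀ w, tlForm δ k n w v = 0}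
  zero_mem' w := map_zero _
  add_mem' {v v'} hv hv' w := by rw [map_add, hv w, hv' w, add_zero]
  smul_mem' r v hv := by
    obtain ⟨x, rfl⟩ := RingQuot.mkAlgHom_surjective 𝕜 (TLRel δ n) r
    induction x using MonoidAlgebra.induction_on with
    | of a =>
      intro w
      rw [tlCell_smul_def, tlCellHom, RingQuot.liftAlgHom_mkAlgHom_apply, MonoidAlgebra.lift_of]
      exact (cellPairing_action (powersHom 𝕜 δ) k n a w v).trans (hv _)
    | add x y hx hy =>
      intro w
      rw [map_add, add_smul, map_add, hx w, hy w, add_zero]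
    | smul c x hx =>
      intro w
      rw [map_smul (RingQuot.mkAlgHom 𝕜 (TLRel δ n)) c x, smul_assoc,
        map_smul (tlForm δ k n w) c, hx w, smul_zero]

/-- The `k`-th simple representation `L(k) = W(k) / R(k)` of the Temperley–Lieb algebra. -/
abbrev TLSimple := TLCell δ k n ⧸ tlRadical δ k n

end TLAlgebra

section CyclicTL

variable (𝕜 : Type*) [Field 𝕜] (m k n : ℕ)

/-- The sandwiched algebra: the group algebra of the cyclic group of order `m`. -/
abbrev CyclicGroupAlgebra := MonoidAlgebra 𝕜 (Multiplicative (ZMod m))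

/-- The cell representation `Δ(k)`, the span of pairs `(x, i)` of a half diagram `x` and an element
`i` of the cyclic group: the free module over the group algebra on the half diagrams, where
`(x, i)` is `Finsupp.single x (MonoidAlgebra.of _ _ (ofAdd i))`. By reflection it is also the
underlying space of the right cell representation `∇(k)`, where a diagram acts from the right through
its reflection. -/
abbrev CyclicCell := HalfDiagram k n →₀ CyclicGroupAlgebra 𝕜 m

/-- The action of the cyclic Temperley–Lieb monoid on `Δ(k)` by concatenation. -/
noncomputable def cyclicAction :
    CyclicTLMonoid m n →* Module.End (CyclicGroupAlgebra 𝕜 m) (CyclicCell 𝕜 m k n) :=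
  cellAction (MonoidAlgebra.of 𝕜 (Multiplicative (ZMod m))) k n

/-- The bilinear map `φ^k`, with values in the sandwiched algebra. -/
noncomputable def cyclicPairing :
    CyclicCell 𝕜 m k n →ₗ[CyclicGroupAlgebra 𝕜 m]
      CyclicCell 𝕜 m k n →ₗ[CyclicGroupAlgebra 𝕜 m] CyclicGroupAlgebra 𝕜 m :=
  cellPairing (MonoidAlgebra.of 𝕜 (Multiplicative (ZMod m))) k n

/-- The map `Δ(k) → Hom_𝕜(∇(k), 𝕜 C_m)` induced by `φ^k`. -/
noncomputable def cyclicPairingHom :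
    CyclicCell 𝕜 m k n →ₗ[CyclicGroupAlgebra 𝕜 m]
      (CyclicCell 𝕜 m k n →ₗ[𝕜] CyclicGroupAlgebra 𝕜 m) where
  toFun v := ((cyclicPairing 𝕜 m k n).flip v).restrictScalars 𝕜
  map_add' v v' := by ext1 w; simp
  map_smul' r v := by ext1 w; simp

variable (K : Type*) [AddCommGroup K] [Module (CyclicGroupAlgebra 𝕜 m) K]

/-- The underlying space of the representation `Δ(k, K)`, the tensor product of `Δ(k)` and `K` over
the sandwiched algebra. -/
def InducedCell := TensorProduct (CyclicGroupAlgebra 𝕜 m) (CyclicCell 𝕜 m k n) K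

noncomputable instance : AddCommGroup (InducedCell 𝕜 m k n K) :=
  inferInstanceAs (AddCommGroup (TensorProduct (CyclicGroupAlgebra 𝕜 m) (CyclicCell 𝕜 m k n) K))

noncomputable instance : Module 𝕜 (InducedCell 𝕜 m k n K) :=
  inferInstanceAs (Module 𝕜 (TensorProduct (CyclicGroupAlgebra 𝕜 m) (CyclicCell 𝕜 m k n) K))

/-- The action of the monoid algebra of the cyclic Temperley–Lieb monoid on `Δ(k, K)`. -/
noncomputable def inducedCellHom : MonoidAlgebra 𝕜 (CyclicTLMonoid m n) →ₐ[𝕜]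
    Module.End (CyclicGroupAlgebra 𝕜 m)
      (TensorProduct (CyclicGroupAlgebra 𝕜 m) (CyclicCell 𝕜 m k n) K) :=
  MonoidAlgebra.lift 𝕜 _ _
    { toFun := fun a => LinearMap.rTensor K (cyclicAction 𝕜 m k n a)
      map_one' := by rw [map_one]; exact LinearMap.rTensor_id _ _
      map_mul' := fun a b => by rw [map_mul]; exact LinearMap.rTensor_comp _ _ _ }

noncomputable instance : Module (MonoidAlgebra 𝕜 (CyclicTLMonoid m n)) (InducedCell 𝕜 m k n K) :=
  Module.compHom (TensorProduct (CyclicGroupAlgebra 𝕜 m) (CyclicCell 𝕜 m k n) K)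
    (inducedCellHom 𝕜 m k n K).toRingHom

theorem inducedCell_smul_def (r : MonoidAlgebra 𝕜 (CyclicTLMonoid m n))
    (v : InducedCell 𝕜 m k n K) : r • v = inducedCellHom 𝕜 m k n K r v := rfl

instance : IsScalarTower 𝕜 (MonoidAlgebra 𝕜 (CyclicTLMonoid m n)) (InducedCell 𝕜 m k n K) where
  smul_assoc c r v := by
    rw [inducedCell_smul_def, inducedCell_smul_def, map_smul]; rfl

/-- The map `φ^k_K : Δ(k, K) → Hom_𝕜(∇(k), 𝕜 C_m) ⊗ K`. -/
noncomputable def inducedPairing :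
    TensorProduct (CyclicGroupAlgebra 𝕜 m) (CyclicCell 𝕜 m k n) K →ₗ[CyclicGroupAlgebra 𝕜 m]
      TensorProduct (CyclicGroupAlgebra 𝕜 m)
        (CyclicCell 𝕜 m k n →ₗ[𝕜] CyclicGroupAlgebra 𝕜 m) K :=
  LinearMap.rTensor K (cyclicPairingHom 𝕜 m k n)

/-- Precomposition of a linear form on `∇(k)` with the action of a diagram. -/
noncomputable def precompAction (a : CyclicTLMonoid m n) :
    (CyclicCell 𝕜 m k n →ₗ[𝕜] CyclicGroupAlgebra 𝕜 m) →ₗ[CyclicGroupAlgebra 𝕜 m]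
      (CyclicCell 𝕜 m k n →ₗ[𝕜] CyclicGroupAlgebra 𝕜 m) where
  toFun f := f ∘ₗ (cyclicAction 𝕜 m k n a.star).restrictScalars 𝕜
  map_add' _ _ := rfl
  map_smul' _ _ := rfl

theorem inducedPairing_action (a : CyclicTLMonoid m n)
    (v : TensorProduct (CyclicGroupAlgebra 𝕜 m) (CyclicCell 𝕜 m k n) K) :
    inducedPairing 𝕜 m k n K (LinearMap.rTensor K (cyclicAction 𝕜 m k n a) v) =
      LinearMap.rTensor K (precompAction 𝕜 m k n a) (inducedPairing 𝕜 m k n K v) := by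
  have h : cyclicPairingHom 𝕜 m k n ∘ₗ cyclicAction 𝕜 m k n a =
      precompAction 𝕜 m k n a ∘ₗ cyclicPairingHom 𝕜 m k n := by
    refine LinearMap.ext fun v => LinearMap.ext fun w => ?_
    exact cellPairing_action (MonoidAlgebra.of 𝕜 (Multiplicative (ZMod m))) k n a w v
  rw [inducedPairing, ← LinearMap.comp_apply, ← LinearMap.rTensor_comp, h, LinearMap.rTensor_comp,
    LinearMap.comp_apply]

/-- The kernel `R(k, K)` of `φ^k_K`, as a subrepresentation of `Δ(k, K)`. -/
noncomputable def inducedRadical :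
    Submodule (MonoidAlgebra 𝕜 (CyclicTLMonoid m n)) (InducedCell 𝕜 m k n K) where
  carrier := {v | inducedPairing 𝕜 m k n K v = 0}
  zero_mem' := map_zero (inducedPairing 𝕜 m k n K)
  add_mem' {v v'} hv hv' := by
    have := map_add (inducedPairing 𝕜 m k n K) v v'
    exact this.trans ((congrArg₂ (· + ·) hv hv').trans (add_zero _))
  smul_mem' r v hv := by
    induction r using MonoidAlgebra.induction_on with
    | of a =>
      change inducedPairing 𝕜 m k n K (inducedCellHom 𝕜 m k n K _ v) = 0
      rw [inducedCellHom, MonoidAlgebra.lift_of]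
      exact (inducedPairing_action 𝕜 m k n K a v).trans ((congrArg _ hv).trans (map_zero _))
    | add x y hx hy =>
      rw [add_smul]
      have := map_add (inducedPairing 𝕜 m k n K) (x • v) (y • v)
      exact this.trans ((congrArg₂ (· + ·) hx hy).trans (add_zero _))
    | smul c x hx =>
      have e : ∀ u : TensorProduct (CyclicGroupAlgebra 𝕜 m) (CyclicCell 𝕜 m k n) K,
          inducedPairing 𝕜 m k n K u = 0 → inducedPairing 𝕜 m k n K (c • u) = 0 := by
        intro u hu
        rw [← algebraMap_smul (CyclicGroupAlgebra 𝕜 m) c u, map_smul, hu, smul_zero]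
      rw [smul_assoc]
      exact e _ hx

/-- The representation `L(k, K) = Δ(k, K) / R(k, K)` of the cyclic Temperley–Lieb monoid. -/
abbrev CyclicTLSimple := InducedCell 𝕜 m k n K ⧸ inducedRadical 𝕜 m k n K

end CyclicTL

section Apex

/-- The two-sided cell order of a monoid. -/
def CellLE {S : Type*} [Monoid S] (a b : S) : Prop := ∃ c d, b = c * a * d

/-- The two-sided cells (`J`-cells) of a monoid: classes of `a ≤ b ∧ b ≤ a`. -/
def IsJCell {S : Type*} [Monoid S] (J : Set S) : Prop :=
  ∃ a, J = {b | CellLE a b ∧ CellLE b a}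

/-- A `J`-cell is idempotent if it contains an idempotent. -/
def IsIdempotentJCell {S : Type*} [Monoid S] (J : Set S) : Prop :=
  IsJCell J ∧ ∃ e ∈ J, e * e = e

/-- `J` acts by zero on the representation `M`. -/
def Annihilates (𝕜 : Type*) [Field 𝕜] {S : Type*} [Monoid S] (J : Set S) (M : Type*)
    [AddCommGroup M] [Module (MonoidAlgebra 𝕜 S) M] : Prop :=
  ∀ s ∈ J, ∀ v : M, MonoidAlgebra.of 𝕜 S s • v = 0

/-- `J` is an apex of `M`: a maximal element, in the two-sided cell order, among the idempotent
`J`-cells that do not annihilate `M`. -/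
def IsApex (𝕜 : Type*) [Field 𝕜] {S : Type*} [Monoid S] (J : Set S) (M : Type*)
    [AddCommGroup M] [Module (MonoidAlgebra 𝕜 S) M] : Prop :=
  (IsIdempotentJCell J ∧ ¬ Annihilates 𝕜 J M) ∧
    ∀ J' : Set S, IsIdempotentJCell J' → ¬ Annihilates 𝕜 J' M →
      (∀ a ∈ J, ∀ b ∈ J', CellLE a b) → J' = J

/-- The cell `J_k` of the cyclic Temperley–Lieb monoid: the diagrams with `k` through strands. -/
def throughCell (m k n : ℕ) : Set (CyclicTLMonoid m n) :=
  {a | throughStrands a.skeleton = k}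

end Apex

/-! Everything rests on one rank-one formula. For half diagrams `x`, `y` the diagram `x y*` sends a
vector `v` of the cell representation to `⟨y, v⟩ x`, up to a scalar recording the circles of `x y*`
(`smul_cellAction_comp_reflect`). It holds because a planar diagram from `k` to `k` points without
caps is the identity (`Capless.eq_idDiag`): `y* z` is either the identity, or has a cap that
survives in `x y* z`. Hence a subspace stable under all diagrams that contains a vector outside the
radical of the form contains every half diagram (`eq_top_of_cellAction_stable`). Since `x* x` is
always the identity, `⟨x, x⟩` is a power of the circle parameter, so for a nonzero parameter the
radical is proper. It is then the unique maximal subrepresentation, and the quotient is simple.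

The cyclic case reduces to this one. On a simple module `K` where the generator acts by `ζ`, the
whole group algebra acts through the character attached to `ζ`, so `K` is a line `𝕜 v₀`. The map `x
↦ (x, 0) ⊗ v₀` identifies `W(k)` with `Δ(k, K)`, and each circle becomes the factor `ζ`
(`exists_cellComparison_equiv`). The kernel of `φ^k_K` is detected by evaluating at the half
diagrams (`inducedPairing_eq_zero_iff`), so it corresponds to the radical of the form with values in
powers of `ζ`. As `ζ^m = 1`, counting circles in `ℕ` or modulo `m` gives the same form, hence the
same radical and the same dimension of the quotient.

For the apex, a diagram with `k` through strands factors as `x y*` (`exists_comp_reflect`), which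
makes `J_k` a single two-sided cell. Products cannot gain through strands, and diagrams with fewer
than `k` of them kill `Δ(k, K)`. Therefore a cell above `J_k` that acts nontrivially meets `J_k`. -/

namespace TLDiagram

/-! ### Planar diagrams: through strands and factorisation into half diagrams -/

variable {k l m n : ℕ}

/-- A component meeting the boundary has exactly two boundary points, so exhibiting one connected
partner for each point determines the composite. -/
theorem comp_eq_of_connected {a : TLDiagram m n} {b : TLDiagram l m} {c : TLDiagram l n}
    (h : ∀ p, Connected a b (outer p) (outer (c.partner p))) : comp a b = c := by
  ext p : 2
  exact ((connected_outer_iff a b p _).1 (h p)).resolve_left (c.partner_ne p) |>.symm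

theorem eq_idDiag_of_partner_inl {d : TLDiagram k k}
    (h : ∀ i, d.partner (.inl i) = .inr i) : d = idDiag k := by
  ext p : 2
  rcases p with i | i
  · exact h i
  · rw [← h i, d.partner_partner, h]; rfl

theorem boundaryPos_inl (i : Fin l) : boundaryPos (.inl i : Fin l ⊕ Fin n) = i := rfl

theorem boundaryPos_inr (j : Fin n) :
    boundaryPos (.inr j : Fin l ⊕ Fin n) = l + (n - (j + 1)) := by
  simp [boundaryPos, Fin.val_rev]

/-- Through strands do not cross. -/
theorem lt_of_through {d : TLDiagram l n} {i i' : Fin l} {j j' : Fin n}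
    (h : d.partner (.inl i) = .inr j) (h' : d.partner (.inl i') = .inr j') (hi : i < i') :
    j < j' := by
  have hne : j ≠ j' := by
    rintro rfl
    have := congrArg d.partner (h.trans h'.symm)
    rw [d.partner_partner, d.partner_partner] at this
    exact hi.ne (Sum.inl.inj this)
  have := d.noncrossing (.inl i) (.inl i')
  rw [h, h'] at this
  simp only [boundaryPos_inl, boundaryPos_inr] at this
  have : (j : ℕ) ≠ j' := fun h => hne (Fin.ext h)
  omega

/-- Every bottom point runs to the top, and planarity makes the resulting map `Fin k → Fin k`
strictly increasing, which leaves only the identity. Consequently a zero value of the pairing always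
means that a cap has appeared. -/
theorem Capless.eq_idDiag {d : TLDiagram k k} (h : Capless d) : d = idDiag k := by
  have hex : ∀ i, ∃ j, d.partner (.inl i) = .inr j := fun i => by
    rcases hd : d.partner (.inl i) with j | j
    · exact absurd hd (h i j)
    · exact ⟨j, rfl⟩
  choose f hf using hex
  have hmono : StrictMono f := fun i i' hi => lt_of_through (hf i) (hf i') hi
  have hid : f = id := by
    have hsurj : Function.Surjective f := Finite.surjective_of_injective hmono.injective
    exact hmono.range_inj strictMono_id |>.1 (by rw [hsurj.range_eq, Set.range_id])
  exact eq_idDiag_of_partner_inl fun i => by rw [hf, hid]; rfl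

/-- A bottom point follows its strand of `x` to the top and returns along the mirror image of the
same strand. The cups of `x` only contribute circles, which `loops` records separately. -/
theorem Capless.reflect_comp_self {x : TLDiagram k n} (h : Capless x) :
    comp (reflect x) x = idDiag k := by
  refine eq_idDiag_of_partner_inl fun i => ?_
  rcases hx : x.partner (.inl i) with j | j
  · exact absurd hx (h i j)
  have h1 := connected_lower (reflect x) x (.inl i)
  have h2 := connected_upper (reflect x) x (.inl j)
  have e : (reflect x).partner (.inl j) = .inr i := by
    simp only [reflect, Sum.swap_inl]
    rw [← hx, x.partner_partner]; rfl
  rw [hx] at h1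
  rw [e] at h2
  have h3 := (connected_outer_iff (reflect x) x (.inl i) (.inr i)).1
    ((Connected (reflect x) x).trans h1 h2)
  exact (h3.resolve_left Sum.inr_ne_inl).symm

/-- The half diagram with `k` vertical strands on the left followed by nested cups. -/
def nestedCups (hkn : k ≤ n) (hpar : k ≡ n [MOD 2]) : TLDiagram k n where
  partner := Sum.elim (fun i => .inr ⟨i, by omega⟩)
    (fun j => if h : (j : ℕ) < k then .inl ⟨j, h⟩ else .inr ⟨n + k - 1 - j, by omega⟩)
  partner_partner := by
    rintro (i | j)
    · simp
    · by_cases h : (j : ℕ) < k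
      · simp [h]
      · have h' : ¬ (n + k - 1 - (j : ℕ) < k) := by omega
        simp only [Sum.elim_inr, dif_neg h, dif_neg h']
        congr 1; ext; simp only; omega
  partner_ne := by
    rintro (i | j)
    · simp
    · by_cases h : (j : ℕ) < k
      · simp [h]
      · simp only [Sum.elim_inr, dif_neg h, ne_eq, Sum.inr.injEq, Fin.ext_iff]
        have : k % 2 = n % 2 := hpar
        omega
  noncrossing := by
    rintro (i | i) (j | j)
    all_goals simp only [Sum.elim_inl, Sum.elim_inr]
    all_goals try split_ifs
    all_goals simp only [boundaryPos_inl, boundaryPos_inr]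
    all_goals omega

theorem capless_nestedCups (hkn : k ≤ n) (hpar : k ≡ n [MOD 2]) :
    Capless (nestedCups hkn hpar) := fun _ _ => by simp [nestedCups]

theorem Capless.throughStrands_eq {x : TLDiagram k n} (h : Capless x) : throughStrands x = k := by
  have : ∀ i, (x.partner (.inl i)).isRight := fun i => by
    rcases hx : x.partner (.inl i) with j | j
    · exact absurd hx (h i j)
    · rfl
  rw [throughStrands, Fintype.card_subtype, Finset.filter_true_of_mem fun i _ => this i,
    Finset.card_univ, Fintype.card_fin]

/-- A cap of `b` survives in the composite, so a bottom point on a through strand of `comp a b`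
already lies on one of `b`. -/
theorem throughStrands_comp_le_right (a : TLDiagram m n) (b : TLDiagram l m) :
    throughStrands (comp a b) ≤ throughStrands b := by
  refine Fintype.card_subtype_mono _ _ fun i hi => ?_
  rcases hb : b.partner (.inl i) with j | j
  · exfalso
    have h1 := connected_lower a b (.inl i)
    rw [hb] at h1
    rcases (connected_outer_iff a b (.inl i) (.inl j)).1 h1 with h2 | h2
    · exact b.partner_ne _ (hb.trans (congrArg _ (Sum.inl.inj h2)))
    · rw [← h2] at hi
      simp at hi
  · rfl

/-- Sending the bottom end of a through strand to its top end is injective. Reflection being an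
involution, this inequality yields equality. -/
theorem throughStrands_le_reflect (a : TLDiagram l n) :
    throughStrands a ≤ throughStrands (reflect a) := by
  have hex : ∀ i : {i : Fin l // (a.partner (.inl i)).isRight}, ∃ j, a.partner (.inl i) = .inr j :=
    fun i => Sum.isRight_iff.1 i.2
  choose f hf using hex
  have hr : ∀ i, (reflect a).partner (.inl (f i)) = .inr i.1 := fun i => by
    simp only [reflect, Sum.swap_inl]
    rw [← hf, a.partner_partner]; rfl
  refine Fintype.card_le_of_injective
    (fun i => (⟨f i, by rw [hr]; rfl⟩ : {j : Fin n // ((reflect a).partner (.inl j)).isRight})) ?_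
  intro i i' h
  have h1 := hr i
  rw [show f i = f i' from Subtype.ext_iff.1 h, hr] at h1
  exact (Subtype.ext (Sum.inr.inj h1)).symm

theorem throughStrands_reflect (a : TLDiagram l n) :
    throughStrands (reflect a) = throughStrands a := by
  refine le_antisymm ?_ (throughStrands_le_reflect a)
  simpa [reflect_reflect] using throughStrands_le_reflect (reflect a)

theorem throughStrands_comp_le_left (a : TLDiagram m n) (b : TLDiagram l m) :
    throughStrands (comp a b) ≤ throughStrands a := by
  rw [← throughStrands_reflect, ← (reflect_comp_and_loops a b).2, ← throughStrands_reflect a]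
  exact throughStrands_comp_le_right _ _

open Classical in
/-- The upper half of a diagram whose through strands end at the top points `f i`. -/
noncomputable def topHalf (a : TLDiagram l n) (f : Fin k → Fin n) (hf : StrictMono f)
    (hr : ∀ j, (∃ i, f i = j) ↔ (a.partner (.inr j)).isLeft) : TLDiagram k n where
  partner := Sum.elim (fun i => .inr (f i))
    (fun j => if h : ∃ i, f i = j then .inl h.choose
      -- The value `.inr j` is a dummy: by `hr`, a top point outside the range of `f` has its
      -- partner on top.
      else Sum.elim (fun _ => .inr j) .inr (a.partner (.inr j)))
  partner_partner := by
    rintro (i | j)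
    · have h : ∃ i', f i' = f i := ⟨i, rfl⟩
      simp only [Sum.elim_inl, Sum.elim_inr, dif_pos h]
      rw [hf.injective h.choose_spec]
    · by_cases h : ∃ i, f i = j
      · simp only [Sum.elim_inr, dif_pos h, Sum.elim_inl]
        rw [h.choose_spec]
      · rcases ha : a.partner (.inr j) with i | j'
        · exact absurd ((hr j).2 (by rw [ha]; rfl)) h
        · have ha' : a.partner (.inr j') = .inr j := by rw [← ha, a.partner_partner]
          have h' : ¬ ∃ i, f i = j' := fun h' => by simpa [ha'] using (hr j').1 h'
          simp [dif_neg h, ha, dif_neg h', ha']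
  partner_ne := by
    rintro (i | j)
    · simp
    · by_cases h : ∃ i, f i = j
      · simp [h]
      · rcases ha : a.partner (.inr j) with i | j'
        · exact absurd ((hr j).2 (by rw [ha]; rfl)) h
        · simp only [Sum.elim_inr, dif_neg h, ha]
          exact fun h2 => a.partner_ne _ (ha.trans (congrArg _ (Sum.inr.inj h2)))
  noncrossing := by
    have hcase : ∀ j, (∃ i, f i = j) ∨ ∃ j', a.partner (.inr j) = .inr j' := fun j => by
      rcases ha : a.partner (.inr j) with i | j'
      · exact Or.inl ((hr j).2 (by rw [ha]; rfl))
      · exact Or.inr ⟨j', rfl⟩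
    have hT : ∀ i, ∃ i', a.partner (.inr (f i)) = .inl i' := fun i =>
      Sum.isLeft_iff.1 ((hr _).1 ⟨i, rfl⟩)
    have hN : ∀ j j', a.partner (.inr j) = .inr j' → ¬ ∃ i, f i = j := fun j j' h h' => by
      simpa [h] using (hr j).1 h'
    have hle : ∀ i i' : Fin k, (i : ℕ) < i' → (f i : ℕ) < f i' := fun i i' h => hf h
    have hch : ∀ i (h : ∃ i', f i' = f i), h.choose = i := fun i h => hf.injective h.choose_spec
    -- The two ways in which strands of the half could cross come from crossings of `a`: `base`
    -- forbids a cup around the end of a through strand, and `two` forbids interleaved cups.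
    -- Positions decrease from left to right on the top line, so the inequalities on indices are
    -- reversed.
    have base : ∀ i j j', a.partner (.inr j) = .inr j' → (j : ℕ) < f i → ¬ (f i : ℕ) < j' := by
      intro i j j' h h1 h2
      obtain ⟨i', hi'⟩ := hT i
      have h3 : a.partner (.inl i') = .inr (f i) := by rw [← hi', a.partner_partner]
      have h4 : a.partner (.inr j') = .inr j := by rw [← h, a.partner_partner]
      have := a.noncrossing (.inl i') (.inr j')
      rw [h3, h4] at this
      simp only [boundaryPos_inl, boundaryPos_inr] at this
      omega
    have two : ∀ j j' q q', a.partner (.inr j) = .inr j' → a.partner (.inr q) = .inr q' →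
        ¬ ((q : ℕ) < j ∧ (j' : ℕ) < q ∧ (q' : ℕ) < j') := by
      intro j j' q q' h h' hlt
      have := a.noncrossing (.inr j) (.inr q)
      rw [h, h'] at this
      simp only [boundaryPos_inr] at this
      omega
    rintro (i | j) (i' | j')
    · have h1 := hle i i'
      simp only [Sum.elim_inl, boundaryPos_inl, boundaryPos_inr]
      omega
    · rcases hcase j' with ⟨t, rfl⟩ | ⟨q, hq⟩
      · have h : ∃ i', f i' = f t := ⟨t, rfl⟩
        simp only [Sum.elim_inl, Sum.elim_inr, dif_pos h, boundaryPos_inl, boundaryPos_inr]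
        omega
      · have h := hN _ _ hq
        have hq' : a.partner (.inr q) = .inr j' := by rw [← hq, a.partner_partner]
        have h1 := base i _ _ hq'
        have h2 : (q : ℕ) ≠ f i := fun e => hN _ _ hq' ⟨i, (Fin.ext e).symm⟩
        have h3 : (j' : ℕ) ≠ f i := fun e => hN _ _ hq ⟨i, (Fin.ext e).symm⟩
        simp only [Sum.elim_inl, Sum.elim_inr, dif_neg h, hq, boundaryPos_inl, boundaryPos_inr]
        omega
    · rcases hcase j with ⟨t, rfl⟩ | ⟨q, hq⟩
      · have h : ∃ i', f i' = f t := ⟨t, rfl⟩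
        simp only [Sum.elim_inl, Sum.elim_inr, dif_pos h, boundaryPos_inl, boundaryPos_inr]
        omega
      · simp only [Sum.elim_inl, Sum.elim_inr, dif_neg (hN _ _ hq), hq, boundaryPos_inl,
          boundaryPos_inr]
        omega
    · rcases hcase j with ⟨t, rfl⟩ | ⟨q, hq⟩
      · have h : ∃ i', f i' = f t := ⟨t, rfl⟩
        simp only [Sum.elim_inr, dif_pos h, boundaryPos_inl, boundaryPos_inr]
        omega
      · rcases hcase j' with ⟨t, rfl⟩ | ⟨q', hq'⟩
        · have h : ∃ i', f i' = f t := ⟨t, rfl⟩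
          simp only [Sum.elim_inr, dif_neg (hN _ _ hq), hq, Sum.elim_inr, dif_pos h,
            boundaryPos_inl, boundaryPos_inr]
          omega
        · have h1 := two _ _ _ _ hq hq'
          simp only [Sum.elim_inr, dif_neg (hN _ _ hq), dif_neg (hN _ _ hq'), hq, hq',
            boundaryPos_inr]
          omega

section TopHalf

variable (a : TLDiagram l n) (f : Fin k → Fin n) (hf : StrictMono f)
  (hr : ∀ j, (∃ i, f i = j) ↔ (a.partner (.inr j)).isLeft)

theorem topHalf_partner_inl (i : Fin k) : (topHalf a f hf hr).partner (.inl i) = .inr (f i) := rfl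

theorem topHalf_partner_inr {j j' : Fin n} (h : a.partner (.inr j) = .inr j') :
    (topHalf a f hf hr).partner (.inr j) = .inr j' := by
  have h' : ¬ ∃ i, f i = j := fun h' => by simpa [h] using (hr j).1 h'
  simp [topHalf, dif_neg h', h]

theorem capless_topHalf : Capless (topHalf a f hf hr) := fun _ _ => Sum.inr_ne_inl

end TopHalf

/-- A diagram with `k` through strands is the composite of a half diagram and a reflected one. -/
theorem exists_comp_reflect (a : TLDiagram l n) (ha : throughStrands a = k) :
    ∃ (x : TLDiagram k n) (y : TLDiagram k l), Capless x ∧ Capless y ∧ comp x (reflect y) = a := by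
  classical
  -- The bottom ends of the through strands are enumerated from left to right by `g`, and `f t` is
  -- the top end of the strand starting at `g t`. Since `f` is increasing as well, the `t`-th
  -- strands of the two halves meet at the middle point `t`.
  set S : Finset (Fin l) := Finset.univ.filter fun i => (a.partner (.inl i)).isRight with hS
  have hcard : S.card = k := by rw [← ha, throughStrands, Fintype.card_subtype]
  set g : Fin k → Fin l := ⇑(S.orderEmbOfFin hcard) with hg
  have hgmono : StrictMono g := (S.orderEmbOfFin hcard).strictMono
  have hgr : ∀ i, (∃ t, g t = i) ↔ (a.partner (.inl i)).isRight := fun i => by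
    have := Finset.range_orderEmbOfFin S hcard
    have h2 : i ∈ Set.range g ↔ i ∈ (S : Set (Fin l)) := by rw [hg, this]
    simpa [hS] using h2
  have hex : ∀ t, ∃ j, a.partner (.inl (g t)) = .inr j := fun t =>
    Sum.isRight_iff.1 ((hgr _).1 ⟨t, rfl⟩)
  choose f hf using hex
  have hf' : ∀ t, a.partner (.inr (f t)) = .inl (g t) := fun t => by
    rw [← hf, a.partner_partner]
  have hfmono : StrictMono f := fun t t' h => lt_of_through (hf t) (hf t') (hgmono h)
  have hfr : ∀ j, (∃ t, f t = j) ↔ (a.partner (.inr j)).isLeft := fun j => by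
    constructor
    · rintro ⟨t, rfl⟩
      rw [hf']; rfl
    · intro h
      obtain ⟨i, hi⟩ := Sum.isLeft_iff.1 h
      have hi' : a.partner (.inl i) = .inr j := by rw [← hi, a.partner_partner]
      obtain ⟨t, rfl⟩ := (hgr i).2 (by rw [hi']; rfl)
      exact ⟨t, Sum.inr.inj ((hf t).symm.trans hi')⟩
  have hgr' : ∀ i, (∃ t, g t = i) ↔ ((reflect a).partner (.inr i)).isLeft := fun i => by
    rw [hgr]; simp [reflect]
  set x := topHalf a f hfmono hfr with hx
  set y := topHalf (reflect a) g hgmono hgr' with hy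
  refine ⟨x, y, capless_topHalf _ _ _ _, capless_topHalf _ _ _ _, comp_eq_of_connected ?_⟩
  have through : ∀ t, Connected x (reflect y) (outer (.inl (g t))) (outer (.inr (f t))) := by
    intro t
    have h1 := connected_lower x (reflect y) (.inr t)
    have h2 := connected_upper x (reflect y) (.inl t)
    have e1 : (reflect y).partner (.inr t) = .inl (g t) := by
      simp only [reflect, Sum.swap_inr, hy, topHalf_partner_inl]
    rw [e1] at h1
    rw [hx, topHalf_partner_inl, ← hx] at h2
    exact (Connected x (reflect y)).trans ((Connected x (reflect y)).symm h1) h2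
  rintro (i | j)
  · rcases hi : a.partner (.inl i) with i' | j
    · have h1 := connected_lower x (reflect y) (.inl i)
      have e1 : (reflect y).partner (.inl i) = .inl i' := by
        have : (reflect a).partner (.inr i) = .inr i' := by simp [reflect, hi]
        have hyi : y.partner (.inr i) = .inr i' := topHalf_partner_inr _ _ _ _ this
        change (y.partner (.inr i)).swap = _
        rw [hyi]; rfl
      rw [e1] at h1
      exact h1
    · obtain ⟨t, rfl⟩ := (hgr i).2 (by rw [hi]; rfl)
      have : f t = j := Sum.inr.inj ((hf t).symm.trans hi)
      rw [← this]
      exact through t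
  · rcases hj : a.partner (.inr j) with i | j'
    · obtain ⟨t, rfl⟩ := (hfr j).2 (by rw [hj]; rfl)
      have : g t = i := Sum.inl.inj ((hf' t).symm.trans hj)
      rw [← this]
      exact (Connected x (reflect y)).symm (through t)
    · have h1 := connected_upper x (reflect y) (.inr j)
      rw [hx, topHalf_partner_inr _ _ _ _ hj, ← hx] at h1
      exact h1

instance : Finite (TLDiagram l n) :=
  Finite.of_injective TLDiagram.partner fun _ _ h => TLDiagram.ext h

end TLDiagram

/-! ### Two-sided cells of the cyclic Temperley–Lieb monoid -/

section CellOrder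

theorem CellLE.trans {S : Type*} [Monoid S] {a b c : S} (h : CellLE a b) (h' : CellLE b c) :
    CellLE a c := by
  obtain ⟨s, t, rfl⟩ := h
  obtain ⟨u, v, rfl⟩ := h'
  exact ⟨u * s, t * v, by simp only [mul_assoc]⟩

theorem IsJCell.eq_of_mem {S : Type*} [Monoid S] {J J' : Set S} (hJ : IsJCell J) (hJ' : IsJCell J')
    {b : S} (hb : b ∈ J) (hb' : b ∈ J') : J = J' := by
  obtain ⟨a, rfl⟩ := hJ
  obtain ⟨a', rfl⟩ := hJ'
  ext c
  exact ⟨fun h => ⟨hb'.1.trans (hb.2.trans h.1), (h.2.trans hb.1).trans hb'.2⟩,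
    fun h => ⟨hb.1.trans (hb'.2.trans h.1), (h.2.trans hb'.1).trans hb.2⟩⟩

variable {m k n : ℕ}

theorem CellLE.throughStrands_le {a b : CyclicTLMonoid m n} (h : CellLE a b) :
    throughStrands b.skeleton ≤ throughStrands a.skeleton := by
  obtain ⟨c, d, rfl⟩ := h
  exact (throughStrands_comp_le_left _ _).trans (throughStrands_comp_le_right _ _)

/-- With `a = x y*` and `b = x' y'*`, the identities `x* x = Id` and `y* y = Id` give `(x' x*)(x
y*)(y y'*) = x' y'*`. -/
theorem cellLE_of_mem_throughCell {a b : CyclicTLMonoid m n} (ha : a ∈ throughCell m k n)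
    (hb : b ∈ throughCell m k n) : CellLE a b := by
  obtain ⟨a, i⟩ := a
  obtain ⟨b, j⟩ := b
  obtain ⟨x, y, hx, hy, rfl⟩ := exists_comp_reflect a ha
  obtain ⟨x', y', hx', hy', rfl⟩ := exists_comp_reflect b hb
  have key : comp (comp (comp x' (reflect x)) (comp x (reflect y))) (comp y (reflect y')) =
      comp x' (reflect y') := by
    rw [← comp_assoc x' (reflect x), comp_assoc (reflect x) x, hx.reflect_comp_self,
      (id_comp_and_loops _).2, ← comp_assoc x', comp_assoc (reflect y) y, hy.reflect_comp_self,
      (id_comp_and_loops _).2]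
  -- The circle count of the left factor is solved for, so that the total is `j`. This uses
  -- subtraction in `ZMod m`.
  refine ⟨⟨comp x' (reflect x), j - i - loops (comp x' (reflect x)) (comp x (reflect y)) -
    loops (comp (comp x' (reflect x)) (comp x (reflect y))) (comp y (reflect y'))⟩,
    ⟨comp y (reflect y'), 0⟩, CountedDiagram.ext key.symm ?_⟩
  simp only [CountedDiagram.mul_bubbles, CountedDiagram.mul_skeleton]
  ring

/-- Neither factor has more than `k` through strands, and none is lost because multiplying by `y` on
the right recovers `x`. -/
theorem TLDiagram.Capless.throughStrands_comp_reflect {x : TLDiagram k n} (hx : Capless x)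
    {y : TLDiagram k n} (hy : Capless y) : throughStrands (comp x (reflect y)) = k := by
  refine le_antisymm ((throughStrands_comp_le_left _ _).trans hx.throughStrands_eq.le) ?_
  have h : comp (comp x (reflect y)) y = x := by
    rw [← comp_assoc, hy.reflect_comp_self, (comp_id_and_loops _).2]
  calc k = throughStrands (comp (comp x (reflect y)) y) := by rw [h, hx.throughStrands_eq]
    _ ≤ _ := throughStrands_comp_le_left _ _

theorem isIdempotentJCell_throughCell (hkn : k ≤ n) (hpar : k ≡ n [MOD 2]) :
    IsIdempotentJCell (throughCell m k n) := by
  set x := nestedCups hkn hpar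
  have hx : Capless x := capless_nestedCups hkn hpar
  have hmem : ∀ i, (⟨comp x (reflect x), i⟩ : CyclicTLMonoid m n) ∈ throughCell m k n := fun _ =>
    hx.throughStrands_comp_reflect hx
  refine ⟨⟨⟨comp x (reflect x), 0⟩, Set.ext fun b => ⟨fun hb =>
      ⟨cellLE_of_mem_throughCell (hmem 0) hb, cellLE_of_mem_throughCell hb (hmem 0)⟩,
      -- The underlying diagram of `x x*` is idempotent. The circle count `i` has to satisfy `i + i
      -- + loops = i`, which forces `i = -loops`.
      fun hb => ?_⟩⟩, ⟨_, -loops (comp x (reflect x)) (comp x (reflect x))⟩, hmem _,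
      CountedDiagram.ext ?_ ?_⟩
  · exact le_antisymm (hb.1.throughStrands_le.trans (hmem 0).le)
      ((hmem 0).ge.trans hb.2.throughStrands_le)
  · rw [CountedDiagram.mul_skeleton, ← comp_assoc x, comp_assoc (reflect x),
      hx.reflect_comp_self, (id_comp_and_loops _).2]
  · rw [CountedDiagram.mul_bubbles]
    ring

end CellOrder

/-! ### The rank-one action of `x y*` on a cell representation -/

section CellGeneration

variable {Λ : Type*} [AddCommMonoidWithOne Λ] {A : Type*} [CommRing A]
  (τ : Multiplicative Λ →* A) {k n : ℕ}

theorem cellAction_single_one (a : CountedDiagram Λ n) (x : HalfDiagram k n) :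
    cellAction τ k n a (Finsupp.single x 1) = cellActBasis τ k n a x := by
  simp [cellAction]

/-- The diagram `x y*` sends `v` to `⟨y, v⟩ x`, up to the factor given by the internal components
of `x y*`. -/
theorem smul_cellAction_comp_reflect (x y : HalfDiagram k n) (v : HalfDiagram k n →₀ A) :
    τ (Multiplicative.ofAdd (loops x.1 (reflect y.1) : Λ)) •
        cellAction τ k n ⟨comp x.1 (reflect y.1), 0⟩ v =
      cellPairing τ k n (Finsupp.single y 1) v • Finsupp.single x 1 := by
  have key : τ (Multiplicative.ofAdd (loops x.1 (reflect y.1) : Λ)) •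
        cellAction τ k n ⟨comp x.1 (reflect y.1), 0⟩ =
      (cellPairing τ k n (Finsupp.single y 1)).smulRight (Finsupp.single x 1) := by
    refine Finsupp.lhom_ext' fun z => LinearMap.ext_ring ?_
    simp only [LinearMap.coe_comp, Function.comp_apply, Finsupp.lsingle_apply,
      LinearMap.smul_apply, LinearMap.smulRight_apply, cellPairing_single, cellAction_single_one]
    have hassoc := comp_assoc x.1 (reflect y.1) z.1
    have hloops := loops_cocycle x.1 (reflect y.1) z.1
    -- If `y* z` is the identity, stacking `x` on it creates no circle, so by the cocycle rule the
    -- circles of `y* z` are those of `x y*` plus those of `(x y*) z`. Otherwise `y* z` has a cap,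
    -- which persists under `x`, and both sides vanish.
    by_cases h : comp (reflect y.1) z.1 = idDiag k
    · rw [h, (comp_id_and_loops _).2] at hassoc
      rw [h, (comp_id_and_loops _).1, add_zero] at hloops
      have hc : Capless (comp (comp x.1 (reflect y.1)) z.1) := by rw [← hassoc]; exact x.2
      rw [cellPairingBasis, if_pos h, cellActBasis, dif_pos hc, Finsupp.smul_single,
        Finsupp.smul_single, smul_eq_mul, smul_eq_mul, mul_one, ← map_mul, ← ofAdd_add]
      congr 1
      · exact Subtype.ext hassoc.symm
      · rw [zero_add, hloops, Nat.cast_add]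
    · have hc : ¬ Capless (comp (comp x.1 (reflect y.1)) z.1) := by
        rw [← hassoc]
        exact fun hc => h hc.of_comp.eq_idDiag
      rw [cellPairingBasis, if_neg h, cellActBasis, dif_neg hc, zero_smul, smul_zero]
  exact LinearMap.congr_fun key v

/-- Being a value of `τ`, this is nonzero as soon as `τ` avoids zero, which is what makes the
radical proper. -/
theorem cellPairing_self (x : HalfDiagram k n) :
    cellPairing τ k n (Finsupp.single x 1) (Finsupp.single x 1) =
      τ (Multiplicative.ofAdd (loops (reflect x.1) x.1 : Λ)) := by
  rw [cellPairing_single, cellPairingBasis, if_pos x.2.reflect_comp_self]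

theorem cellPairing_eq_zero_iff (v : HalfDiagram k n →₀ A) :
    (∀ w, cellPairing τ k n w v = 0) ↔ ∀ y, cellPairing τ k n (Finsupp.single y 1) v = 0 := by
  refine ⟨fun h y => h _, fun h w => ?_⟩
  have : (cellPairing τ k n).flip v = 0 := Finsupp.lhom_ext' fun y => LinearMap.ext_ring (by
    simpa using h y)
  exact LinearMap.congr_fun this w

/-- A capless result has `k` through strands, and these must all pass through `a`. With fewer
strands available, `a` kills every basis vector. -/
theorem throughStrands_of_cellAction_ne_zero {a : CountedDiagram Λ n} {v : HalfDiagram k n →₀ A}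
    (h : cellAction τ k n a v ≠ 0) : k ≤ throughStrands a.skeleton := by
  by_contra hk
  have : cellAction τ k n a = 0 := Finsupp.lhom_ext' fun x => LinearMap.ext_ring (by
    simp only [LinearMap.coe_comp, Function.comp_apply, Finsupp.lsingle_apply,
      cellAction_single_one, LinearMap.zero_apply]
    refine dif_neg fun hc => hk ?_
    rw [← hc.throughStrands_eq]
    exact throughStrands_comp_le_left _ _)
  exact h (by rw [this]; rfl)

end CellGeneration

/-! ### Subspaces outside the radical -/

section Field

variable {𝕜 : Type*} [Field 𝕜] {Λ : Type*} [AddCommMonoidWithOne Λ]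
  (τ : Multiplicative Λ →* 𝕜) {k n : ℕ}

/-- A subspace stable under all diagrams that contains a vector outside the radical of the form is
the whole cell representation. -/
theorem eq_top_of_cellAction_stable (N : Submodule 𝕜 (HalfDiagram k n →₀ 𝕜))
    (hN : ∀ a, ∀ v ∈ N, cellAction τ k n a v ∈ N) {v w : HalfDiagram k n →₀ 𝕜} (hv : v ∈ N)
    (hvw : cellPairing τ k n w v ≠ 0) : N = ⊤ := by
  have hex : ∃ y, cellPairing τ k n (Finsupp.single y 1) v ≠ 0 := by
    by_contra! h
    exact hvw ((cellPairing_eq_zero_iff τ v).2 h w)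
  obtain ⟨y, hy⟩ := hex
  -- Applying `x y*` to `v` and scaling by the value of `τ` produces `⟨y, v⟩ x` with `⟨y, v⟩ ≠ 0`.
  -- Only this pairing has to be inverted, not the value of `τ`.
  have hx : ∀ x, Finsupp.single x 1 ∈ N := fun x => by
    have h := N.smul_mem (τ (Multiplicative.ofAdd (loops x.1 (reflect y.1) : Λ)))
      (hN ⟨comp x.1 (reflect y.1), 0⟩ v hv)
    rw [smul_cellAction_comp_reflect] at h
    exact (N.smul_mem_iff hy).1 h
  rw [eq_top_iff]
  intro u _
  rw [← Finsupp.sum_single u]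
  refine N.sum_mem fun x _ => ?_
  rw [← mul_one (u x), ← smul_eq_mul, ← Finsupp.smul_single]
  exact N.smul_mem _ (hx x)

/-- Since `ζ^m = 1`, the power of `ζ` depends on the number of circles only modulo `m`. -/
theorem cellPairing_zmodChar {m : ℕ} [NeZero m] {ζ : 𝕜} (hζ : ζ ^ m = 1) :
    cellPairing (AddChar.zmodChar m hζ).toMonoidHom k n = cellPairing (powersHom 𝕜 ζ) k n := by
  have : cellPairingBasis (AddChar.zmodChar m hζ).toMonoidHom k n =
      cellPairingBasis (powersHom 𝕜 ζ) k n := by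
    funext y x
    simp only [cellPairingBasis, AddChar.toMonoidHom_apply, toAdd_ofAdd, AddChar.zmodChar_apply',
      powersHom_apply, Nat.cast_id]
  rw [cellPairing, this, cellPairing]

end Field

/-- If the submodules not contained in a proper submodule `R` are everything, then `R` is the Jacobson
radical. -/
theorem Submodule.eq_jacobson_of_forall_eq_top {S M : Type*} [Ring S] [AddCommGroup M] [Module S M]
    {R : Submodule S M} (hR : R ≠ ⊤) (h : ∀ N : Submodule S M, ¬ N ≤ R → N = ⊤) :
    IsCoatom R ∧ R = Module.jacobson S M := by
  have hco : IsCoatom R := ⟨hR, fun N hN => h N hN.not_ge⟩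
  refine ⟨hco, le_antisymm (le_sInf fun N hN => ?_) (sInf_le hco)⟩
  by_contra hle
  refine hR (h R fun hRR => ?_)
  -- A maximal submodule inside the proper `R` equals `R`; one not inside `R` would be everything.
  by_cases hNR : N ≤ R
  · exact hle ((hN.le_iff_eq hR).1 hNR).le
  · exact hN.1 (h N hNR)

/-! ### Simplicity of `L(k)` for a nonzero circle parameter -/

section TLSimple

variable {𝕜 : Type*} [Field 𝕜] {δ : 𝕜} {k n : ℕ}

theorem tlCell_mk_of_smul (a : KauffmanMonoid n) (v : TLCell δ k n) :
    RingQuot.mkAlgHom 𝕜 (TLRel δ n) (MonoidAlgebra.of 𝕜 _ a) • v =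
      cellAction (powersHom 𝕜 δ) k n a v := by
  rw [tlCell_smul_def, tlCellHom, RingQuot.liftAlgHom_mkAlgHom_apply, MonoidAlgebra.lift_of]

/-- The nested-cup diagram pairs with itself to a power of `δ`, so `R(k)` is proper, and every
subrepresentation not inside `R(k)` is all of `W(k)`. The conditions on `k` and `n` guarantee that a
half diagram exists. -/
theorem isSimpleModule_tlSimple (hδ : δ ≠ 0) (hkn : k ≤ n) (hpar : k ≡ n [MOD 2]) :
    IsSimpleModule (TLAlgebra δ n) (TLSimple δ k n) := by
  have hτ : ∀ i, powersHom 𝕜 δ i ≠ 0 := fun i => pow_ne_zero _ hδ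
  rw [isSimpleModule_iff_isCoatom]
  refine (Submodule.eq_jacobson_of_forall_eq_top ?_ fun N hN => ?_).1
  · intro h
    let x : HalfDiagram k n := ⟨nestedCups hkn hpar, capless_nestedCups hkn hpar⟩
    have hx : (Finsupp.single x 1 : HalfDiagram k n →₀ 𝕜) ∈ (tlRadical δ k n) := by
      rw [h]; trivial
    exact hτ _ ((cellPairing_self (powersHom 𝕜 δ) x).symm.trans (hx (Finsupp.single x (1 : 𝕜))))
  · obtain ⟨v, hv, hvR⟩ := SetLike.not_le_iff_exists.1 hN
    obtain ⟨w, hw⟩ := not_forall.1 hvR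
    have := eq_top_of_cellAction_stable (powersHom 𝕜 δ) (N.restrictScalars 𝕜)
      (fun a u hu => by
        change cellAction (powersHom 𝕜 δ) k n a u ∈ N
        have h := tlCell_mk_of_smul (δ := δ) a u
        exact h ▸ N.smul_mem _ hu) hv hw
    exact (Submodule.restrictScalars_eq_top_iff 𝕜 _ _).1 this

instance : Module.Finite 𝕜 (TLCell δ k n) :=
  inferInstanceAs (Module.Finite 𝕜 (HalfDiagram k n →₀ 𝕜))

end TLSimple
open scoped TensorProduct

/-! ### The kernel of the induced pairing on `Δ(k, K)` -/

section EvalTensor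

variable {R : Type*} [CommRing R] {M K : Type*} [AddCommGroup M] [Module R M] [AddCommGroup K]
  [Module R K]

/-- Apply a linear form to the first tensor factor. -/
noncomputable def evalTensor (K : Type*) [AddCommGroup K] [Module R K] (φ : M →ₗ[R] R) :
    M ⊗[R] K →ₗ[R] K :=
  TensorProduct.lift (LinearMap.lsmul R K ∘ₗ φ)

theorem evalTensor_tmul (φ : M →ₗ[R] R) (x : M) (v : K) : evalTensor K φ (x ⊗ₜ v) = φ x • v := rfl

end EvalTensor

section Comparison

variable {𝕜 : Type*} [Field 𝕜] {m k n : ℕ} {K : Type*} [AddCommGroup K]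
  [Module (CyclicGroupAlgebra 𝕜 m) K]

/-- The comparison map `W(k) → Δ(k, K)`, `x ↦ (x, 0) ⊗ v₀`. -/
noncomputable def cellComparison (𝕜 : Type*) [Field 𝕜] (m k n : ℕ) {K : Type*}
    [AddCommGroup K] [Module (CyclicGroupAlgebra 𝕜 m) K] (v₀ : K) :
    (HalfDiagram k n →₀ 𝕜) →ₗ[𝕜] CyclicCell 𝕜 m k n ⊗[CyclicGroupAlgebra 𝕜 m] K :=
  ((TensorProduct.mk (CyclicGroupAlgebra 𝕜 m) (CyclicCell 𝕜 m k n) K).flip v₀).restrictScalars 𝕜 ∘ₗ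
    Finsupp.mapRange.linearMap (Algebra.linearMap 𝕜 (CyclicGroupAlgebra 𝕜 m))

theorem cellComparison_single (x : HalfDiagram k n) (c : 𝕜) (v₀ : K) :
    cellComparison 𝕜 m k n v₀ (Finsupp.single x c) =
      (Finsupp.single x 1 : CyclicCell 𝕜 m k n) ⊗ₜ
        (algebraMap 𝕜 (CyclicGroupAlgebra 𝕜 m) c • v₀) := by
  have h : cellComparison 𝕜 m k n v₀ (Finsupp.single x c) =
      (Finsupp.single x (algebraMap 𝕜 (CyclicGroupAlgebra 𝕜 m) c) : CyclicCell 𝕜 m k n) ⊗ₜ v₀ := by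
    simp [cellComparison]
  rw [h, ← TensorProduct.smul_tmul, Finsupp.smul_single, smul_eq_mul, mul_one]

/-- Scalars of `𝕜` act on `K` only through the group algebra, where a nonzero scalar is still a
unit. -/
theorem algebraMap_smul_eq_zero {v₀ : K} (hv₀ : v₀ ≠ 0) {c : 𝕜}
    (h : algebraMap 𝕜 (CyclicGroupAlgebra 𝕜 m) c • v₀ = 0) : c = 0 := by
  by_contra hc
  refine hv₀ ?_
  have := congrArg (algebraMap 𝕜 (CyclicGroupAlgebra 𝕜 m) c⁻¹ • ·) h
  simpa only [← mul_smul, ← map_mul, inv_mul_cancel₀ hc, map_one, one_smul, smul_zero] using this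

/-- The coordinate form at `x`, applied to the first tensor factor, recovers the coefficient at `x`
as a multiple of `v₀`. -/
theorem cellComparison_injective {v₀ : K} (hv₀ : v₀ ≠ 0) :
    Function.Injective (cellComparison 𝕜 m k n v₀) := by
  refine (injective_iff_map_eq_zero _).2 fun g hg => Finsupp.ext fun x => ?_
  have h := congrArg (evalTensor K (Finsupp.lapply x)) hg
  have e : cellComparison 𝕜 m k n v₀ g =
      (Finsupp.mapRange.linearMap (Algebra.linearMap 𝕜 (CyclicGroupAlgebra 𝕜 m)) g) ⊗ₜ v₀ := rfl
  rw [e, evalTensor_tmul, map_zero] at h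
  exact algebraMap_smul_eq_zero hv₀ h

/-- The form `φ^k(-, f)` is linear over the group algebra, so it is the sum of the coordinate forms
weighted by its values at the half diagrams. These weights move across the tensor sign. -/
theorem inducedPairing_eq_sum [Fintype (HalfDiagram k n)]
    (v : CyclicCell 𝕜 m k n ⊗[CyclicGroupAlgebra 𝕜 m] K) :
    inducedPairing 𝕜 m k n K v = ∑ y : HalfDiagram k n,
      ((Finsupp.lapply y : CyclicCell 𝕜 m k n →ₗ[CyclicGroupAlgebra 𝕜 m] _).restrictScalars 𝕜) ⊗ₜ
        evalTensor K (cyclicPairing 𝕜 m k n (Finsupp.single y 1)) v := by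
  induction v using TensorProduct.induction_on with
  | zero => simp
  | add u v hu hv =>
    rw [map_add, hu, hv, ← Finset.sum_add_distrib]
    exact Finset.sum_congr rfl fun y _ => by rw [map_add, TensorProduct.tmul_add]
  | tmul f v =>
    simp only [evalTensor_tmul, ← TensorProduct.smul_tmul, ← TensorProduct.sum_tmul]
    rw [inducedPairing, LinearMap.rTensor_tmul]
    congr 1
    refine LinearMap.ext fun w => ?_
    have hw : w = ∑ y, w y • Finsupp.single y (1 : CyclicGroupAlgebra 𝕜 m) := by
      simp [Finsupp.univ_sum_single]
    change cyclicPairing 𝕜 m k n w f = _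
    conv_lhs => rw [hw, map_sum, LinearMap.sum_apply]
    rw [LinearMap.sum_apply]
    refine Finset.sum_congr rfl fun y _ => ?_
    rw [map_smul, LinearMap.smul_apply, LinearMap.smul_apply, smul_eq_mul, mul_comm]
    rfl

/-- Evaluation at `y` is a linear map out of the Hom space, so each functional on the right factors
through `φ^k_K`. Conversely, their values determine `φ^k_K` by the expansion in coordinate forms, so
no exactness of the tensor product is needed. -/
theorem inducedPairing_eq_zero_iff (v : CyclicCell 𝕜 m k n ⊗[CyclicGroupAlgebra 𝕜 m] K) :
    inducedPairing 𝕜 m k n K v = 0 ↔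
      ∀ y, evalTensor K (cyclicPairing 𝕜 m k n (Finsupp.single y 1)) v = 0 := by
  have := Fintype.ofFinite (HalfDiagram k n)
  constructor
  · intro h y
    let ev : (CyclicCell 𝕜 m k n →ₗ[𝕜] CyclicGroupAlgebra 𝕜 m) →ₗ[CyclicGroupAlgebra 𝕜 m]
        CyclicGroupAlgebra 𝕜 m :=
      { toFun := fun f => f (Finsupp.single y 1), map_add' := fun _ _ => rfl,
        map_smul' := fun _ _ => rfl }
    have e : evalTensor K (cyclicPairing 𝕜 m k n (Finsupp.single y 1)) =
        evalTensor K ev ∘ₗ inducedPairing 𝕜 m k n K := TensorProduct.ext' fun _ _ => rfl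
    rw [e, LinearMap.comp_apply, h, map_zero]
  · intro h
    rw [inducedPairing_eq_sum]
    exact Finset.sum_eq_zero fun y _ => by rw [h, TensorProduct.tmul_zero]

theorem of_smul_inducedCell (a : CyclicTLMonoid m n) (v : InducedCell 𝕜 m k n K) :
    MonoidAlgebra.of 𝕜 _ a • v = LinearMap.rTensor K (cyclicAction 𝕜 m k n a) v := by
  rw [inducedCell_smul_def, inducedCellHom, MonoidAlgebra.lift_of]
  rfl

end Comparison

/-! ### Scalar action of the cyclic group and comparison of `W(k)` with `Δ(k, K)` -/

section RootOfUnity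

variable {𝕜 : Type*} [Field 𝕜] {m k n : ℕ} [NeZero m] {ζ : 𝕜}

/-- The character of the group algebra of the cyclic group given by a root of unity. -/
noncomputable def cyclicCharacter (hζ : ζ ^ m = 1) : CyclicGroupAlgebra 𝕜 m →ₐ[𝕜] 𝕜 :=
  MonoidAlgebra.lift 𝕜 𝕜 _ (AddChar.zmodChar m hζ).toMonoidHom

theorem cyclicCharacter_of (hζ : ζ ^ m = 1) (i : Multiplicative (ZMod m)) :
    cyclicCharacter hζ (MonoidAlgebra.of 𝕜 _ i) = (AddChar.zmodChar m hζ).toMonoidHom i :=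
  MonoidAlgebra.lift_of _ _

variable {K : Type*} [AddCommGroup K] [Module (CyclicGroupAlgebra 𝕜 m) K]

/-- Each element of the cyclic group is a natural power of the generator and hence acts by the same
power of `ζ`; linearity does the rest. -/
theorem smul_eq_cyclicCharacter_smul (hζ : ζ ^ m = 1)
    (hKζ : ∀ v : K, MonoidAlgebra.of 𝕜 (Multiplicative (ZMod m)) (Multiplicative.ofAdd 1) • v =
      algebraMap 𝕜 (CyclicGroupAlgebra 𝕜 m) ζ • v)
    (r : CyclicGroupAlgebra 𝕜 m) (v : K) :
    r • v = algebraMap 𝕜 (CyclicGroupAlgebra 𝕜 m) (cyclicCharacter hζ r) • v := by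
  induction r using MonoidAlgebra.induction_on with
  | of a =>
    have hpow : ∀ j : ℕ, MonoidAlgebra.of 𝕜 (Multiplicative (ZMod m))
        (Multiplicative.ofAdd (j : ZMod m)) • v =
          algebraMap 𝕜 (CyclicGroupAlgebra 𝕜 m) (ζ ^ j) • v := by
      intro j
      induction j with
      | zero => simp [← MonoidAlgebra.one_def]
      | succ j ih =>
        rw [Nat.cast_succ, add_comm, ofAdd_add, map_mul, mul_smul, ih, hKζ, ← mul_smul, ← map_mul,
          pow_succ']
    have h := hpow a.toAdd.val
    rw [ZMod.natCast_zmod_val, ofAdd_toAdd] at h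
    rw [h, cyclicCharacter_of]
    rfl
  | add x y hx hy => rw [add_smul, hx, hy, map_add, map_add, add_smul]
  | smul c x hx =>
    rw [map_smul, smul_eq_mul, map_mul, mul_smul, ← hx, ← mul_smul, Algebra.smul_def]

theorem cellComparison_surjective (hζ : ζ ^ m = 1)
    (hKζ : ∀ v : K, MonoidAlgebra.of 𝕜 (Multiplicative (ZMod m)) (Multiplicative.ofAdd 1) • v =
      algebraMap 𝕜 (CyclicGroupAlgebra 𝕜 m) ζ • v)
    [IsSimpleModule (CyclicGroupAlgebra 𝕜 m) K] {v₀ : K}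
    (hv₀ : v₀ ≠ 0) : Function.Surjective (cellComparison 𝕜 m k n v₀) := by
  rw [← LinearMap.range_eq_top, eq_top_iff]
  rintro u -
  induction u using TensorProduct.induction_on with
  | zero => exact Submodule.zero_mem _
  | add u v hu hv => exact Submodule.add_mem _ hu hv
  | tmul f v =>
    induction f using Finsupp.induction_linear with
    | zero => rw [TensorProduct.zero_tmul]; exact Submodule.zero_mem _
    | add f g hf hg => rw [TensorProduct.add_tmul]; exact Submodule.add_mem _ hf hg
    | single x r =>
      -- By simplicity `v = s v₀`. The tensor is then `x ⊗ (r s) v₀`, and `r s` acts on `v₀` by the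
      -- scalar that its character gives.
      obtain ⟨s, rfl⟩ := IsSimpleModule.toSpanSingleton_surjective
        (CyclicGroupAlgebra 𝕜 m) hv₀ v
      refine ⟨Finsupp.single x (cyclicCharacter hζ (r * s)), ?_⟩
      rw [cellComparison_single, ← smul_eq_cyclicCharacter_smul hζ hKζ,
        LinearMap.toSpanSingleton_apply, mul_smul, ← TensorProduct.smul_tmul, Finsupp.smul_single,
        smul_eq_mul, mul_one]

/-- The circles produced by `a x` appear in `Δ(k)` as an element of the cyclic group. Moved across
the tensor sign, it acts on `v₀` by the corresponding power of `ζ`. -/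
theorem cellComparison_cellAction (hζ : ζ ^ m = 1)
    (hKζ : ∀ v : K, MonoidAlgebra.of 𝕜 (Multiplicative (ZMod m)) (Multiplicative.ofAdd 1) • v =
      algebraMap 𝕜 (CyclicGroupAlgebra 𝕜 m) ζ • v)
    (a : CyclicTLMonoid m n) (v₀ : K) (g : HalfDiagram k n →₀ 𝕜) :
    cellComparison 𝕜 m k n v₀ (cellAction (AddChar.zmodChar m hζ).toMonoidHom k n a g) =
      LinearMap.rTensor K (cyclicAction 𝕜 m k n a) (cellComparison 𝕜 m k n v₀ g) := by
  have key : cellComparison 𝕜 m k n v₀ ∘ₗ cellAction (AddChar.zmodChar m hζ).toMonoidHom k n a =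
      (LinearMap.rTensor K (cyclicAction 𝕜 m k n a)).restrictScalars 𝕜 ∘ₗ
        cellComparison 𝕜 m k n v₀ := by
    refine Finsupp.lhom_ext' fun x => LinearMap.ext_ring ?_
    simp only [LinearMap.coe_comp, Function.comp_apply, Finsupp.lsingle_apply,
      cellAction_single_one, LinearMap.coe_restrictScalars, cellComparison_single,
      LinearMap.rTensor_tmul, map_one, one_smul]
    rw [cyclicAction, cellAction_single_one, cellActBasis, cellActBasis]
    split_ifs
    · rw [cellComparison_single, ← cyclicCharacter_of, ← smul_eq_cyclicCharacter_smul hζ hKζ,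
        ← TensorProduct.smul_tmul, Finsupp.smul_single, smul_eq_mul, mul_one]
    · rw [map_zero, TensorProduct.zero_tmul]
  exact LinearMap.congr_fun key g

/-- The form on `W(k)` is the character applied to the pairing with values in the group algebra, and
this is how such values act on `v₀`. -/
theorem evalTensor_cellComparison (hζ : ζ ^ m = 1)
    (hKζ : ∀ v : K, MonoidAlgebra.of 𝕜 (Multiplicative (ZMod m)) (Multiplicative.ofAdd 1) • v =
      algebraMap 𝕜 (CyclicGroupAlgebra 𝕜 m) ζ • v)
    (y : HalfDiagram k n) (v₀ : K) (g : HalfDiagram k n →₀ 𝕜) :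
    evalTensor K (cyclicPairing 𝕜 m k n (Finsupp.single y 1)) (cellComparison 𝕜 m k n v₀ g) =
      algebraMap 𝕜 (CyclicGroupAlgebra 𝕜 m)
        (cellPairing (AddChar.zmodChar m hζ).toMonoidHom k n (Finsupp.single y 1) g) • v₀ := by
  induction g using Finsupp.induction_linear with
  | zero => simp
  | add f g hf hg => rw [map_add, map_add, hf, hg, map_add, map_add, add_smul]
  | single x c =>
    have hc : (Finsupp.single x c : HalfDiagram k n →₀ 𝕜) = c • Finsupp.single x 1 := by simp
    rw [cellComparison_single, evalTensor_tmul, hc, map_smul, cellPairing_single, cyclicPairing,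
      cellPairing_single, smul_eq_mul, mul_comm c, map_mul, mul_smul, cellPairingBasis,
      cellPairingBasis]
    split_ifs
    · rw [← cyclicCharacter_of, ← smul_eq_cyclicCharacter_smul hζ hKζ]
    · simp

/-! ### The comparison isomorphism; head, apex and dimension -/

variable [IsSimpleModule (CyclicGroupAlgebra 𝕜 m) K]

/-- For an `m`-th root of unity `ζ`, the cell representations `W(k)` and `Δ(k, K)` are identified
compatibly with the actions of diagrams and with the radicals. -/
theorem exists_cellComparison_equiv (hζ : ζ ^ m = 1)
    (hKζ : ∀ v : K, MonoidAlgebra.of 𝕜 (Multiplicative (ZMod m)) (Multiplicative.ofAdd 1) • v =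
      algebraMap 𝕜 (CyclicGroupAlgebra 𝕜 m) ζ • v)
    (k n : ℕ) :
    ∃ e : (HalfDiagram k n →₀ 𝕜) ≃ₗ[𝕜] InducedCell 𝕜 m k n K,
      (∀ (a : CyclicTLMonoid m n) (v : HalfDiagram k n →₀ 𝕜), MonoidAlgebra.of 𝕜 _ a • e v =
        e (cellAction (AddChar.zmodChar m hζ).toMonoidHom k n a v)) ∧
      ∀ v, e v ∈ inducedRadical 𝕜 m k n K ↔
        ∀ w, cellPairing (AddChar.zmodChar m hζ).toMonoidHom k n w v = 0 := by
  have := IsSimpleModule.nontrivial (CyclicGroupAlgebra 𝕜 m) K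
  obtain ⟨v₀, hv₀⟩ := exists_ne (0 : K)
  refine ⟨LinearEquiv.ofBijective (cellComparison 𝕜 m k n v₀)
    ⟨cellComparison_injective hv₀, cellComparison_surjective hζ hKζ hv₀⟩, fun a v => ?_, fun v => ?_⟩
  · rw [of_smul_inducedCell]
    exact (cellComparison_cellAction hζ hKζ a v₀ v).symm
  · change inducedPairing 𝕜 m k n K (cellComparison 𝕜 m k n v₀ v) = 0 ↔
      ∀ w, cellPairing (AddChar.zmodChar m hζ).toMonoidHom k n w v = 0
    rw [inducedPairing_eq_zero_iff, cellPairing_eq_zero_iff]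
    refine forall_congr' fun y => ?_
    rw [evalTensor_cellComparison hζ hKζ]
    exact ⟨algebraMap_smul_eq_zero hv₀, fun h => by rw [h, map_zero, zero_smul]⟩

theorem isCoatom_inducedRadical (hζ : ζ ^ m = 1)
    (hKζ : ∀ v : K, MonoidAlgebra.of 𝕜 (Multiplicative (ZMod m)) (Multiplicative.ofAdd 1) • v =
      algebraMap 𝕜 (CyclicGroupAlgebra 𝕜 m) ζ • v)
    (hkn : k ≤ n) (hpar : k ≡ n [MOD 2]) :
    IsCoatom (inducedRadical 𝕜 m k n K) ∧ inducedRadical 𝕜 m k n K =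
      Module.jacobson (MonoidAlgebra 𝕜 (CyclicTLMonoid m n)) (InducedCell 𝕜 m k n K) := by
  obtain ⟨e, he, heR⟩ := exists_cellComparison_equiv hζ hKζ k n
  refine Submodule.eq_jacobson_of_forall_eq_top (fun h => ?_) fun N hN => ?_
  · let x : HalfDiagram k n := ⟨nestedCups hkn hpar, capless_nestedCups hkn hpar⟩
    have hx := (heR (Finsupp.single x 1)).1 (by rw [h]; trivial) (Finsupp.single x 1)
    rw [cellPairing_self] at hx
    -- A character of a group takes unit values, so the self-pairing of the nested-cup diagram
    -- cannot vanish.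
    exact ((Group.isUnit _).map (AddChar.zmodChar m hζ).toMonoidHom).ne_zero hx
  · obtain ⟨v, hv, hvR⟩ := SetLike.not_le_iff_exists.1 hN
    obtain ⟨u, rfl⟩ := e.surjective v
    rw [heR] at hvR
    obtain ⟨w, hw⟩ := not_forall.1 hvR
    have h := eq_top_of_cellAction_stable (AddChar.zmodChar m hζ).toMonoidHom
      ((N.restrictScalars 𝕜).comap e.toLinearMap)
      (fun a u hu => by
        change e (cellAction (AddChar.zmodChar m hζ).toMonoidHom k n a u) ∈ N
        rw [← he]
        exact N.smul_mem _ hu) hv hw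
    refine eq_top_iff.2 fun v _ => ?_
    obtain ⟨u, rfl⟩ := e.surjective v
    exact (h ▸ Submodule.mem_top : u ∈ (N.restrictScalars 𝕜).comap e.toLinearMap)

theorem not_annihilates_throughCell (hζ : ζ ^ m = 1)
    (hKζ : ∀ v : K, MonoidAlgebra.of 𝕜 (Multiplicative (ZMod m)) (Multiplicative.ofAdd 1) • v =
      algebraMap 𝕜 (CyclicGroupAlgebra 𝕜 m) ζ • v)
    (hkn : k ≤ n) (hpar : k ≡ n [MOD 2]) :
    ¬ Annihilates 𝕜 (throughCell m k n) (CyclicTLSimple 𝕜 m k n K) := by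
  obtain ⟨e, he, heR⟩ := exists_cellComparison_equiv hζ hKζ k n
  set τ := (AddChar.zmodChar m hζ).toMonoidHom
  have hτ0 : ∀ i, τ i ≠ 0 := fun i => ((Group.isUnit i).map τ).ne_zero
  set x : HalfDiagram k n := ⟨nestedCups hkn hpar, capless_nestedCups hkn hpar⟩
  intro h
  have h1 := h ⟨comp x.1 (reflect x.1), 0⟩ (x.2.throughStrands_comp_reflect x.2)
    (Submodule.Quotient.mk (e (Finsupp.single x (1 : 𝕜))))
  rw [← Submodule.Quotient.mk_smul, Submodule.Quotient.mk_eq_zero, he, heR] at h1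
  have h2 := h1 (Finsupp.single x (1 : 𝕜))
  -- If `x x*` sent `x` into the radical, pairing the result with `x` would give zero. By the
  -- rank-one formula it gives `⟨x, x⟩²` up to the circle factor, and `⟨x, x⟩` is a value of `τ`.
  have h3 := congrArg (cellPairing τ k n (Finsupp.single x 1))
    (smul_cellAction_comp_reflect τ x x (Finsupp.single x 1))
  rw [map_smul, map_smul, cellPairing_self] at h3
  rw [h2, smul_zero, smul_eq_mul] at h3
  exact mul_ne_zero (hτ0 _) (hτ0 _) h3.symm

theorem le_throughStrands_of_smul_ne_zero (hζ : ζ ^ m = 1)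
    (hKζ : ∀ v : K, MonoidAlgebra.of 𝕜 (Multiplicative (ZMod m)) (Multiplicative.ofAdd 1) • v =
      algebraMap 𝕜 (CyclicGroupAlgebra 𝕜 m) ζ • v)
    {a : CyclicTLMonoid m n}
    {v : CyclicTLSimple 𝕜 m k n K} (h : MonoidAlgebra.of 𝕜 _ a • v ≠ 0) :
    k ≤ throughStrands a.skeleton := by
  obtain ⟨e, he, -⟩ := exists_cellComparison_equiv hζ hKζ k n
  obtain ⟨v, rfl⟩ := Submodule.Quotient.mk_surjective _ v
  obtain ⟨u, rfl⟩ := e.surjective v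
  refine throughStrands_of_cellAction_ne_zero (AddChar.zmodChar m hζ).toMonoidHom (v := u)
    fun h0 => h ?_
  rw [← Submodule.Quotient.mk_smul, he, h0, map_zero, Submodule.Quotient.mk_zero]

/-- Going up in the cell order loses through strands, while acting nontrivially requires at least
`k` of them. An element of a competing cell that acts nontrivially therefore has exactly `k`, and
cells that share an element coincide. -/
theorem isApex_throughCell (hζ : ζ ^ m = 1)
    (hKζ : ∀ v : K, MonoidAlgebra.of 𝕜 (Multiplicative (ZMod m)) (Multiplicative.ofAdd 1) • v =
      algebraMap 𝕜 (CyclicGroupAlgebra 𝕜 m) ζ • v)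
    (hkn : k ≤ n) (hpar : k ≡ n [MOD 2]) :
    IsApex 𝕜 (throughCell m k n) (CyclicTLSimple 𝕜 m k n K) := by
  have hid := isIdempotentJCell_throughCell (m := m) hkn hpar
  refine ⟨⟨hid, not_annihilates_throughCell hζ hKζ hkn hpar⟩, fun J' hJ' hann hle => ?_⟩
  obtain ⟨b, hb, hbv⟩ : ∃ b ∈ J', ∃ v : CyclicTLSimple 𝕜 m k n K,
      MonoidAlgebra.of 𝕜 _ b • v ≠ 0 := by
    simpa only [Annihilates, not_forall, exists_prop] using hann
  obtain ⟨v, hv⟩ := hbv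
  obtain ⟨e, he, -⟩ := hid.2
  have hbk : b ∈ throughCell m k n :=
    le_antisymm ((hle e he b hb).throughStrands_le.trans (le_of_eq he))
      (le_throughStrands_of_smul_ne_zero hζ hKζ hv)
  exact hJ'.1.eq_of_mem hid.1 hb hbk

/-- The comparison isomorphism carries `R(k)` onto `R(k, K)`, because the forms with circles counted
in `ℕ` and in `ZMod m` agree at `ζ`; it descends to the quotients. -/
theorem nonempty_tlSimple_equiv (hζ : ζ ^ m = 1)
    (hKζ : ∀ v : K, MonoidAlgebra.of 𝕜 (Multiplicative (ZMod m)) (Multiplicative.ofAdd 1) • v =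
      algebraMap 𝕜 (CyclicGroupAlgebra 𝕜 m) ζ • v)
    (k n : ℕ) :
    Nonempty (TLSimple ζ k n ≃ₗ[𝕜] CyclicTLSimple 𝕜 m k n K) := by
  obtain ⟨e, -, heR⟩ := exists_cellComparison_equiv hζ hKζ k n
  have heR' : ∀ v, e v ∈ inducedRadical 𝕜 m k n K ↔ v ∈ tlRadical ζ k n := fun v => by
    rw [heR, cellPairing_zmodChar]; rfl
  refine ⟨(Submodule.Quotient.restrictScalarsEquiv 𝕜 (tlRadical ζ k n)).symm ≪≫ₗ
    Submodule.Quotient.equiv _ ((inducedRadical 𝕜 m k n K).restrictScalars 𝕜) e ?_ ≪≫ₗ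
    Submodule.Quotient.restrictScalarsEquiv 𝕜 (inducedRadical 𝕜 m k n K)⟩
  ext v
  obtain ⟨u, rfl⟩ := e.surjective v
  constructor
  · rintro ⟨u', hu', h⟩
    rw [← h]
    exact (heR' u').2 hu'
  · exact fun h => ⟨u, (heR' u).1 h, rfl⟩

end RootOfUnity

theorem theoremT {𝕜 : Type*} [Field 𝕜] (m n k : ℕ) [NeZero m] (hkn : k ≤ n)
    (hpar : k ≡ n [MOD 2]) (hprim : ∃ ξ : 𝕜, IsPrimitiveRoot ξ m) (ζ : 𝕜) (hζ : ζ ^ m = 1)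
    (K : Type*) [AddCommGroup K] [Module (CyclicGroupAlgebra 𝕜 m) K]
    (hK : IsSimpleModule (CyclicGroupAlgebra 𝕜 m) K)
    (hKζ : ∀ v : K, MonoidAlgebra.of 𝕜 (Multiplicative (ZMod m)) (Multiplicative.ofAdd 1) • v =
      algebraMap 𝕜 (CyclicGroupAlgebra 𝕜 m) ζ • v) :
    inducedRadical 𝕜 m k n K =
        Module.jacobson (MonoidAlgebra 𝕜 (CyclicTLMonoid m n)) (InducedCell 𝕜 m k n K) ∧
      IsSimpleModule (MonoidAlgebra 𝕜 (CyclicTLMonoid m n)) (CyclicTLSimple 𝕜 m k n K) ∧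
      IsApex 𝕜 (throughCell m k n) (CyclicTLSimple 𝕜 m k n K) ∧
      IsSimpleModule (TLAlgebra ζ n) (TLSimple ζ k n) ∧
      Module.Finite 𝕜 (CyclicTLSimple 𝕜 m k n K) ∧
      Module.Finite 𝕜 (TLSimple ζ k n) ∧
      Module.finrank 𝕜 (CyclicTLSimple 𝕜 m k n K) = Module.finrank 𝕜 (TLSimple ζ k n) := by
  have hζ0 : ζ ≠ 0 := fun h => by simp [h, NeZero.ne m] at hζ
  obtain ⟨hco, hjac⟩ := isCoatom_inducedRadical hζ hKζ hkn hpar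
  obtain ⟨e⟩ := nonempty_tlSimple_equiv hζ hKζ k n
  have hfin : Module.Finite 𝕜 (TLSimple ζ k n) :=
    Module.Finite.equiv (Submodule.Quotient.restrictScalarsEquiv 𝕜 (tlRadical ζ k n))
  exact ⟨hjac, isSimpleModule_iff_isCoatom.2 hco, isApex_throughCell hζ hKζ hkn hpar,
    isSimpleModule_tlSimple hζ0 hkn hpar, Module.Finite.equiv e, hfin, e.finrank_eq.symm⟩
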